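/- The order of an entire function $f$ is $\limsup_{r\to\infty}\frac{\log\log M_f(r)}{\log r}$, where $M_f(r)=\max_{|z|=r}|f(z)|$. A real entire function is an entire function that is real on the real axis. Let $\mathcal{LP}^a$ be the set of real entire functions of the form $$\varphi(z)=c\,z^m e^{az^2+bz}\prod_{k=1}^{\omega}\Bigl(1-\frac z{x_k}\Bigr)e^{\lambda z/x_k},\qquad 0\le\omega\le\infty,$$ with $m\in\mathbb N\cup\{0\}$, $b,c\in\mathbb R$, $a<0$, $\lambda\in\{0,1\}$, and nonzero real $x_k$, arranged by increasing $|x_k|$, such that $\sum_k|x_k|^{-\lambda-1}<\infty$. (The superscript in $\mathcal{LP}^a$ is part of the name of the class and not a parameter.) **Theorem 3.** For every $\rho\in[0,2]$ there is a real entire function $\psi$ of order $\rho$ which is a canonical product $$\psi(z)=\prod_{n=1}^{\infty}\Bigl(1-\frac z{x_n}\Bigr)\exp\Bigl(\frac{\lambda z}{x_n}\Bigr)$$ with infinitely many nonzero real zeros $x_n$, arranged by increasing $|x_n|$, where $\lambda\in\{0,1\}$ is the genus, that is, the smallest integer $p\ge 0$ for which $\sum_n|x_n|^{-p-1}$ converges,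 such that for every $a<0$ the function $$\varphi(z)=\exp(az^2)\,\psi(z)=\sum_{n=0}^\infty a_nz^n$$ is in $\mathcal{LP}^a$ and has the following property: for every $n_0\in\mathbb N$ there is $n>n_0$ such that $a_{n-1}a_{n+1}>0$. Consequently the following question (Question A) has a negative answer: is it true that a real entire function $\varphi(z)=\sum_{n=0}^\infty a_nz^n$ with only real zeros is in $\mathcal{LP}^a$ if and only if $0<\limsup_{n\to\infty} n|a_n|^{2/n}<\infty$ and there is $n_0\in\mathbb N$ such that $a_{n-1}a_{n+1}\le 0$ for all $n>n_0$? -/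

import Mathlib

open Filter Topology

noncomputable section

/-- The maximum modulus `M(r) = max_{|z| = r} |f z|`. -/
def maxModulus (f : ℂ → ℂ) (r : ℝ) : ℝ :=
  sSup ((fun z => ‖f z‖) '' Metric.sphere (0 : ℂ) r)

/-- The order `limsup_{r → ∞} log log M(r) / log r` of an entire function
(it is `0` for constant functions). -/
def entireOrder (f : ℂ → ℂ) : EReal :=
  limsup (fun r : ℝ => ((Real.log (Real.log (maxModulus f r)) / Real.log r : ℝ) : EReal)) atTop

/-- A real entire function: entire, and real on the real axis. -/
def IsRealEntire (f : ℂ → ℂ) : Prop :=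
  Differentiable ℂ f ∧ ∀ t : ℝ, (f t).im = 0

/-- `a` is the (real) sequence of Maclaurin coefficients of `f`, and the series represents `f`
in the whole plane. -/
def HasMaclaurinCoeffs (f : ℂ → ℂ) (a : ℕ → ℝ) : Prop :=
  ∀ z : ℂ, HasSum (fun n : ℕ => (a n : ℂ) * z ^ n) (f z)

/-- The factor `(1 - z / t) exp (l z / t)` belonging to the real zero `t ≠ 0`. -/
def zeroFactor (l : ℕ) (t : ℝ) (z : ℂ) : ℂ :=
  (1 - z / t) * Complex.exp (l * z / t)

/-- The representation
`f z = c z^m exp (a z² + b z) ∏_{k < ω} (1 - z / x_k) exp (l z / x_k)`, `0 ≤ ω ≤ ∞`,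
with `m ∈ ℕ`, `b, c ∈ ℝ`, `l ∈ {0, 1}`, nonzero real `x_k` arranged by increasing `|x_k|`, and
`∑ |x_k|^(-l-1) < ∞` (so the product converges absolutely); it is `1` if `ω = 0`. -/
def HasLPRepresentation (f : ℂ → ℂ) (a : ℝ) : Prop :=
  ∃ (c b : ℝ) (m l : ℕ) (ω : ℕ∞) (x : ℕ → ℝ),
    (l = 0 ∨ l = 1) ∧
    (∀ k ∈ {k : ℕ | (k : ℕ∞) < ω}, x k ≠ 0) ∧
    MonotoneOn (fun k => |x k|) {k : ℕ | (k : ℕ∞) < ω} ∧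
    Summable (fun k : {k : ℕ | (k : ℕ∞) < ω} => (|x k| ^ (l + 1))⁻¹) ∧
    ∀ z : ℂ, f z = c * z ^ m * Complex.exp (a * z ^ 2 + b * z) *
      ∏' k : {k : ℕ | (k : ℕ∞) < ω}, zeroFactor l (x k) z

/-- The Laguerre–Pólya class. -/
def LaguerrePolya : Set (ℂ → ℂ) :=
  {f | IsRealEntire f ∧ ∃ a : ℝ, a ≤ 0 ∧ HasLPRepresentation f a}

/-- The subclass of the Laguerre–Pólya class in which the constant `a` in the factor
`exp (a z²)` of the representation is nonzero. -/
def LaguerrePolyaA : Set (ℂ → ℂ) :=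
  {f | IsRealEntire f ∧ ∃ a : ℝ, a ≤ 0 ∧ a ≠ 0 ∧ HasLPRepresentation f a}

/-- `f` is the canonical product of genus `l ∈ {0, 1}` with the nonzero real zeros
`x 0, x 1, …`, arranged by increasing absolute value. The genus is the least
natural number `p` such that `∑ |x n|^(-p-1)` converges. -/
def IsRealCanonicalProduct (f : ℂ → ℂ) (l : ℕ) (x : ℕ → ℝ) : Prop :=
  (l = 0 ∨ l = 1) ∧
  (∀ n, x n ≠ 0) ∧
  Monotone (fun n => |x n|) ∧
  IsLeast {p : ℕ | Summable fun n => (|x n| ^ (p + 1))⁻¹} l ∧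
  ∀ z : ℂ, HasProd (fun n => zeroFactor l (x n) z) (f z)

/-- The conjectural characterization: a real entire function with only real zeros is in
`LaguerrePolyaA` if and only if `0 < limsup n |a_n|^(2/n) < ∞` and `a_{n-1} a_{n+1} ≤ 0` for
all sufficiently large `n`. -/
def SignPatternCharacterization : Prop :=
  ∀ (f : ℂ → ℂ) (a : ℕ → ℝ), IsRealEntire f → (∀ z, f z = 0 → z.im = 0) →
    HasMaclaurinCoeffs f a →
    (f ∈ LaguerrePolyaA ↔
      (0 < limsup (fun n : ℕ => ENNReal.ofReal (n * |a n| ^ (2 / n : ℝ))) atTop ∧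
        limsup (fun n : ℕ => ENNReal.ofReal (n * |a n| ^ (2 / n : ℝ))) atTop < ⊤) ∧
      ∃ n₀ : ℕ, ∀ n > n₀, a (n - 1) * a (n + 1) ≤ 0)

end

/-! The contradiction comes from the imaginary axis. If `a_{n-1} a_{n+1} ≤ 0` for all large `n` and
the coefficients of large even index do not vanish, then `(-1)^k a_{2k}` eventually has constant
sign, so `Re φ(iy) = ∑ (-1)^k a_{2k} y^{2k}` has a strict constant sign for large `y`
(`HasMaclaurinCoeffs.re_pos_of_coeff_pos`). But `exp (a z²)` is positive at `z = iy`, and the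
argument of `ψ(iy)` is continuous and unbounded when `ψ` has infinitely many positive zeros, because
all factors turn in the same direction. So `Re φ(iy)` is `≥ 0` and `≤ 0` arbitrarily far out
(`exists_re_canonicalProduct`).

It remains to prevent infinitely many even coefficients from vanishing, for all `a < 0` at once.
Start from a canonical product `P` with the desired order and genus `l`, and prepend three zeros
whose reciprocals have sum 6 and elementary symmetric functions `e₂`, `e₃`. This multiplies `P` by
`(1 - 6z + e₂z² - e₃z³) exp (6lz)`. With the sum fixed, `E = exp (6lz) P` does not depend on `e₂`,
`e₃`. The coefficients `F n` of `exp (a z²) E` are polynomials in `a`. If two even coefficients of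
`φ` vanish at the same `a`, eliminating `e₂` makes `a` a root of a nonzero polynomial independent of
`e₂`, so only countably many `a` occur. Each such `a` excludes one value of `e₂`, or, if the factor
of `e₂` vanishes, one value of `e₃` (`exists_generic_parameters`).

The last case needs that two consecutive coefficients of `exp (a z²) E` never both vanish. This
series is a coefficientwise limit of real-rooted polynomials. For such limits with nonzero constant
term, two consecutive zero coefficients kill all later ones (`coeff_eq_zero_of_consecutive`), which
is impossible with infinitely many zeros. -/

/-! ### Convergence of canonical products with positive zeros -/

theorem norm_zeroFactor_sub_one_le {l : ℕ} (hl : l = 0 ∨ l = 1) {δ t R : ℝ} (hδ : 0 < δ)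
    (ht : δ ≤ t) {z : ℂ} (hz : ‖z‖ ≤ R) :
    ‖zeroFactor l t z - 1‖ ≤ (R + 2 * R ^ 2 * Real.exp (R / δ)) * (t ^ (l + 1))⁻¹ := by
  have ht0 : 0 < t := hδ.trans_le ht
  have hR : 0 ≤ R := (norm_nonneg z).trans hz
  have hw : ‖z / (t : ℂ)‖ = ‖z‖ / t := by simp [abs_of_pos ht0]
  rcases hl with rfl | rfl
  · have : zeroFactor 0 t z - 1 = -(z / t) := by simp [zeroFactor]
    rw [this, norm_neg, hw, zero_add, pow_one, ← div_eq_mul_inv]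
    gcongr
    have : 0 ≤ 2 * R ^ 2 * Real.exp (R / δ) := by positivity
    linarith
  · set w : ℂ := z / t with hwdef
    -- The linear terms cancel: `(1 - w) e^w - 1 = (e^w - 1 - w) - w (e^w - 1)`, and both summands
    -- are quadratic in `w`.
    have h1 : zeroFactor 1 t z - 1 = (Complex.exp w - ∑ m ∈ Finset.range 2, w ^ m / (m.factorial : ℂ))
        - w * (Complex.exp w - ∑ m ∈ Finset.range 1, w ^ m / (m.factorial : ℂ)) := by
      simp [zeroFactor, Finset.sum_range_succ, ← hwdef]
      ring
    have h2 := Complex.norm_exp_sub_sum_le_norm_mul_exp w 2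
    have h3 := Complex.norm_exp_sub_sum_le_norm_mul_exp w 1
    have h4 : ‖w‖ ≤ R / t := by rw [hw]; gcongr
    have h5 : R / t ≤ R / δ := by gcongr
    calc ‖zeroFactor 1 t z - 1‖ ≤ ‖w‖ ^ 2 * Real.exp ‖w‖ + ‖w‖ * (‖w‖ ^ 1 * Real.exp ‖w‖) := by
          rw [h1]
          refine (norm_sub_le _ _).trans (add_le_add h2 ?_)
          rw [norm_mul]; gcongr
      _ = 2 * ‖w‖ ^ 2 * Real.exp ‖w‖ := by ring
      _ ≤ 2 * (R / t) ^ 2 * Real.exp (R / δ) := by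
          have := h4.trans h5
          gcongr
      _ = (2 * R ^ 2 * Real.exp (R / δ)) * (t ^ (1 + 1))⁻¹ := by field_simp
      _ ≤ _ := by gcongr; linarith

/-- The canonical product of genus `l` with zeros `x n`. -/
noncomputable def canonicalProduct (l : ℕ) (x : ℕ → ℝ) (z : ℂ) : ℂ := ∏' n, zeroFactor l (x n) z

theorem differentiable_zeroFactor (l : ℕ) (t : ℝ) : Differentiable ℂ (zeroFactor l t) := by
  unfold zeroFactor; fun_prop

section
variable {l : ℕ} {x : ℕ → ℝ} {δ : ℝ}

theorem summable_norm_zeroFactor_sub_one (hl : l = 0 ∨ l = 1) (hδ : 0 < δ) (hx : ∀ n, δ ≤ x n)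
    (hs : Summable fun n => (x n ^ (l + 1))⁻¹) (z : ℂ) :
    Summable fun n => ‖zeroFactor l (x n) z - 1‖ :=
  Summable.of_nonneg_of_le (fun _ => norm_nonneg _)
    (fun n => norm_zeroFactor_sub_one_le hl hδ (hx n) le_rfl) (hs.mul_left _)

theorem hasProd_canonicalProduct (hl : l = 0 ∨ l = 1) (hδ : 0 < δ) (hx : ∀ n, δ ≤ x n)
    (hs : Summable fun n => (x n ^ (l + 1))⁻¹) (z : ℂ) :
    HasProd (fun n => zeroFactor l (x n) z) (canonicalProduct l x z) := by
  have := (multipliable_one_add_of_summable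
    (summable_norm_zeroFactor_sub_one hl hδ hx hs z)).hasProd
  simpa [canonicalProduct] using this

theorem canonicalProduct_ne_zero (hl : l = 0 ∨ l = 1) (hδ : 0 < δ) (hx : ∀ n, δ ≤ x n)
    (hs : Summable fun n => (x n ^ (l + 1))⁻¹) {z : ℂ} (hz : ∀ n, z ≠ x n) :
    canonicalProduct l x z ≠ 0 := by
  have := tprod_one_add_ne_zero_of_summable (f := fun n => zeroFactor l (x n) z - 1) (fun n => ?_)
    (summable_norm_zeroFactor_sub_one hl hδ hx hs z)
  · simpa [canonicalProduct] using this
  · have hxn : (x n : ℂ) ≠ 0 := by exact_mod_cast (hδ.trans_le (hx n)).ne'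
    have : 1 - z / (x n : ℂ) ≠ 0 := by
      rw [sub_ne_zero, ne_comm, ne_eq, div_eq_one_iff_eq hxn]; exact hz n
    simp [zeroFactor, this]

theorem canonicalProduct_zero (l : ℕ) (x : ℕ → ℝ) : canonicalProduct l x 0 = 1 := by
  simp [canonicalProduct, zeroFactor]

theorem canonicalProduct_apply_zero (hl : l = 0 ∨ l = 1) (hδ : 0 < δ) (hx : ∀ n, δ ≤ x n)
    (hs : Summable fun n => (x n ^ (l + 1))⁻¹) (n : ℕ) : canonicalProduct l x (x n) = 0 := by
  have h := hasProd_canonicalProduct hl hδ hx hs (x n)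
  have hxn : (x n : ℂ) ≠ 0 := by exact_mod_cast (hδ.trans_le (hx n)).ne'
  refine tendsto_nhds_unique h.tendsto_prod_nat (tendsto_const_nhds.congr' ?_)
  filter_upwards [eventually_gt_atTop n] with N hN
  refine (Finset.prod_eq_zero (Finset.mem_range.2 hN) ?_).symm
  simp [zeroFactor, hxn]

theorem tendstoLocallyUniformlyOn_canonicalProduct (hl : l = 0 ∨ l = 1) (hδ : 0 < δ)
    (hx : ∀ n, δ ≤ x n) (hs : Summable fun n => (x n ^ (l + 1))⁻¹) :
    TendstoLocallyUniformlyOn (fun N z => ∏ n ∈ Finset.range N, zeroFactor l (x n) z)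
      (canonicalProduct l x) atTop Set.univ := by
  rw [tendstoLocallyUniformlyOn_iff_forall_isCompact isOpen_univ]
  intro K _ hK
  obtain ⟨R, hR⟩ := hK.isBounded.exists_norm_le
  have hR' : K ⊆ Metric.ball (0 : ℂ) (R + 1) := fun z hz => by
    simpa using (hR z hz).trans_lt (lt_add_one R)
  have h := Summable.hasProdLocallyUniformlyOn_nat_one_add (f := fun n z => zeroFactor l (x n) z - 1)
    (K := Metric.ball (0 : ℂ) (R + 1)) Metric.isOpen_ball
    (hs.mul_left ((R + 1) + 2 * (R + 1) ^ 2 * Real.exp ((R + 1) / δ)))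
    (Eventually.of_forall fun n z hz => norm_zeroFactor_sub_one_le hl hδ (hx n)
      (by simpa using (Metric.mem_ball.1 hz).le))
    (fun n => ((differentiable_zeroFactor l (x n)).continuous.sub continuous_const).continuousOn)
  have h2 := h.tendstoLocallyUniformlyOn_finsetRange
  rw [tendstoLocallyUniformlyOn_iff_forall_isCompact Metric.isOpen_ball] at h2
  have h3 := h2 K hR' hK
  simp only [add_sub_cancel] at h3
  exact h3

theorem differentiable_canonicalProduct (hl : l = 0 ∨ l = 1) (hδ : 0 < δ) (hx : ∀ n, δ ≤ x n)
    (hs : Summable fun n => (x n ^ (l + 1))⁻¹) : Differentiable ℂ (canonicalProduct l x) := by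
  rw [← differentiableOn_univ]
  refine (tendstoLocallyUniformlyOn_canonicalProduct hl hδ hx hs).differentiableOn
    (Eventually.of_forall fun N => ?_) isOpen_univ
  exact (Differentiable.fun_finsetProd fun n _ => differentiable_zeroFactor l (x n)).differentiableOn

theorem zeroFactor_conj (l : ℕ) (t : ℝ) (z : ℂ) :
    zeroFactor l t (starRingEnd ℂ z) = starRingEnd ℂ (zeroFactor l t z) := by
  simp [zeroFactor, ← Complex.exp_conj]

theorem canonicalProduct_conj (hl : l = 0 ∨ l = 1) (hδ : 0 < δ) (hx : ∀ n, δ ≤ x n)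
    (hs : Summable fun n => (x n ^ (l + 1))⁻¹) (z : ℂ) :
    canonicalProduct l x (starRingEnd ℂ z) = starRingEnd ℂ (canonicalProduct l x z) := by
  have h := (hasProd_canonicalProduct hl hδ hx hs z).map (starRingEnd ℂ) Complex.continuous_conj
  refine (hasProd_canonicalProduct hl hδ hx hs _).unique ?_
  simpa [Function.comp_def, zeroFactor_conj] using h

theorem canonicalProduct_add (k : ℕ) (hl : l = 0 ∨ l = 1) (hδ : 0 < δ) (hx : ∀ n, δ ≤ x n)
    (hs : Summable fun n => (x n ^ (l + 1))⁻¹) (z : ℂ) :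
    canonicalProduct l x z = (∏ n ∈ Finset.range k, zeroFactor l (x n) z) *
      canonicalProduct l (fun n => x (n + k)) z := by
  have h := hasProd_canonicalProduct hl hδ (fun n => hx (n + k))
    ((summable_nat_add_iff k).2 hs) z
  have h2 := HasProd.prod_range_mul (f := fun n => zeroFactor l (x n) z) h
  exact (hasProd_canonicalProduct hl hδ hx hs z).unique h2

end

/-! ### Maclaurin coefficients: uniqueness, products, Cauchy's estimate, limits -/

section Maclaurin

theorem maclaurin_coeff_unique {f : ℂ → ℂ} {c d : ℕ → ℂ}
    (hc : ∀ z, HasSum (fun n => c n * z ^ n) (f z))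
    (hd : ∀ z, HasSum (fun n => d n * z ^ n) (f z)) : c = d := by
  have key : ∀ e : ℕ → ℂ, (∀ z, HasSum (fun n => e n * z ^ n) (f z)) →
      HasFPowerSeriesAt f (FormalMultilinearSeries.ofScalars ℂ e) 0 := by
    intro e he
    rw [hasFPowerSeriesAt_iff]
    refine Eventually.of_forall fun z => ?_
    have := he z
    simpa [FormalMultilinearSeries.coeff_ofScalars, mul_comm] using this
  have h := (key c hc).eq_formalMultilinearSeries (key d hd)
  funext n
  have := congrArg (fun p : FormalMultilinearSeries ℂ ℂ ℂ => p.coeff n) h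
  simpa [FormalMultilinearSeries.coeff_ofScalars] using this

theorem HasMaclaurinCoeffs.unique {f : ℂ → ℂ} {a b : ℕ → ℝ} (ha : HasMaclaurinCoeffs f a)
    (hb : HasMaclaurinCoeffs f b) : a = b := by
  have := maclaurin_coeff_unique ha hb
  funext n
  exact_mod_cast congrFun this n

theorem HasMaclaurinCoeffs.coeff_eq {f : ℂ → ℂ} {a : ℕ → ℝ} (ha : HasMaclaurinCoeffs f a)
    (hf : Differentiable ℂ f) (n : ℕ) : (a n : ℂ) = (n.factorial : ℂ)⁻¹ * iteratedDeriv n f 0 := by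
  have h := maclaurin_coeff_unique (c := fun n => (a n : ℂ))
    (d := fun n => (n.factorial : ℂ)⁻¹ * iteratedDeriv n f 0) ha fun z => by
      have := Complex.hasSum_taylorSeries_of_entire hf 0 z
      simpa [smul_eq_mul, mul_comm, mul_left_comm, mul_assoc] using this
  exact congrFun h n

/-- An entire function commuting with complex conjugation has real Maclaurin coefficients. -/
theorem exists_hasMaclaurinCoeffs {f : ℂ → ℂ} (hf : Differentiable ℂ f)
    (hc : ∀ z, f (starRingEnd ℂ z) = starRingEnd ℂ (f z)) :
    ∃ G : PowerSeries ℝ, HasMaclaurinCoeffs f fun n => PowerSeries.coeff n G := by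
  set c : ℕ → ℂ := fun n => (n.factorial : ℂ)⁻¹ * iteratedDeriv n f 0 with hcdef
  have h1 : ∀ z, HasSum (fun n => c n * z ^ n) (f z) := fun z => by
    have := Complex.hasSum_taylorSeries_of_entire hf 0 z
    simpa [hcdef, smul_eq_mul, mul_comm, mul_left_comm, mul_assoc] using this
  have h2 : ∀ z, HasSum (fun n => starRingEnd ℂ (c n) * z ^ n) (f z) := fun z => by
    have := (h1 (starRingEnd ℂ z)).map (starRingEnd ℂ) Complex.continuous_conj
    simpa [Function.comp_def, hc] using this
  have h3 := maclaurin_coeff_unique h1 h2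
  refine ⟨PowerSeries.mk fun n => (c n).re, fun z => ?_⟩
  refine HasSum.congr_fun (h1 z) fun n => ?_
  have := Complex.conj_eq_iff_re.1 (congrFun h3 n).symm
  simp [this]

theorem HasMaclaurinCoeffs.mul {f g : ℂ → ℂ} {A B : PowerSeries ℝ}
    (hA : HasMaclaurinCoeffs f fun n => PowerSeries.coeff n A)
    (hB : HasMaclaurinCoeffs g fun n => PowerSeries.coeff n B) :
    HasMaclaurinCoeffs (fun z => f z * g z) fun n => PowerSeries.coeff n (A * B) := by
  intro z
  have hA' := (hA z).summable.norm
  have hB' := (hB z).summable.norm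
  have h := (summable_norm_sum_mul_antidiagonal_of_summable_norm hA' hB').of_norm.hasSum
  rw [← tsum_mul_tsum_eq_tsum_sum_antidiagonal_of_summable_norm hA' hB', (hA z).tsum_eq,
    (hB z).tsum_eq] at h
  refine HasSum.congr_fun h fun n => ?_
  simp only
  rw [PowerSeries.coeff_mul, Complex.ofReal_sum, Finset.sum_mul]
  refine Finset.sum_congr rfl fun p hp => ?_
  rw [← Finset.HasAntidiagonal.mem_antidiagonal.1 hp, pow_add]
  push_cast
  ring

theorem hasMaclaurinCoeffs_polynomial (p : Polynomial ℝ) :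
    HasMaclaurinCoeffs (fun z => Polynomial.aeval z p)
      fun n => PowerSeries.coeff n (p : PowerSeries ℝ) := by
  intro z
  have e : Polynomial.aeval z p =
      ∑ n ∈ Finset.range (p.natDegree + 1), ((p.coeff n : ℝ) : ℂ) * z ^ n := by
    simp [Polynomial.aeval_eq_sum_range]
  have := hasSum_sum_of_ne_finset_zero (L := .unconditional ℕ) (f := fun n => ((p.coeff n : ℝ) : ℂ) * z ^ n)
    (s := Finset.range (p.natDegree + 1)) fun n hn => by
      rw [Polynomial.coeff_eq_zero_of_natDegree_lt (by simpa using hn)]; simp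
  simpa [Polynomial.coeff_coe, e] using this

/-- The Maclaurin series of `exp (c z)`. -/
noncomputable def expLinear (c : ℝ) : PowerSeries ℝ := PowerSeries.mk fun i => c ^ i / (i.factorial : ℝ)

theorem hasMaclaurinCoeffs_expLinear (c : ℝ) :
    HasMaclaurinCoeffs (fun z => Complex.exp (c * z))
      fun n => PowerSeries.coeff n (expLinear c) := by
  intro z
  have := NormedSpace.expSeries_div_hasSum_exp (𝔸 := ℂ) (c * z)
  rw [← Complex.exp_eq_exp_ℂ] at this
  refine HasSum.congr_fun this fun n => ?_
  simp [expLinear, mul_pow]; ring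

/-- The Maclaurin series of `exp (a z²)`. -/
noncomputable def expSq (a : ℝ) : PowerSeries ℝ :=
  PowerSeries.mk fun i => if 2 ∣ i then a ^ (i / 2) / ((i / 2).factorial : ℝ) else 0

theorem hasMaclaurinCoeffs_expSq (a : ℝ) :
    HasMaclaurinCoeffs (fun z => Complex.exp (a * z ^ 2))
      fun n => PowerSeries.coeff n (expSq a) := by
  intro z
  have := NormedSpace.expSeries_div_hasSum_exp (𝔸 := ℂ) (a * z ^ 2)
  rw [← Complex.exp_eq_exp_ℂ] at this
  have hinj : Function.Injective fun n : ℕ => 2 * n := fun m n h => by simpa using h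
  refine (hinj.hasSum_iff fun n hn => ?_).1 ?_
  rotate_left
  · refine HasSum.congr_fun this fun n => ?_
    simp [expSq, mul_pow, ← pow_mul]; ring
  · have : ¬ 2 ∣ n := fun ⟨m, hm⟩ => hn ⟨m, hm.symm⟩
    simp [expSq, this]

/-- Cauchy's estimate. -/
theorem HasMaclaurinCoeffs.abs_coeff_mul_pow_le {f : ℂ → ℂ} {a : ℕ → ℝ}
    (ha : HasMaclaurinCoeffs f a) (hf : Differentiable ℂ f) {R B : ℝ} (hR : 0 < R)
    (hB : ∀ z, ‖z‖ = R → ‖f z‖ ≤ B) (n : ℕ) : |a n| * R ^ n ≤ B := by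
  have h := Complex.norm_iteratedDeriv_le_of_forall_mem_sphere_norm_le n hR
    (c := 0) hf.diffContOnCl (fun z hz => hB z (by simpa using hz))
  have h2 : |a n| = (n.factorial : ℝ)⁻¹ * ‖iteratedDeriv n f 0‖ := by
    rw [← Real.norm_eq_abs, ← Complex.norm_real, ha.coeff_eq hf n]; simp
  have h3 : (0 : ℝ) < n.factorial := by positivity
  rw [h2]
  calc _ ≤ (n.factorial : ℝ)⁻¹ * (n.factorial * B / R ^ n) * R ^ n := by gcongr
    _ = B := by field_simp

/-- Locally uniform limits of entire functions have convergent Maclaurin coefficients. -/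
theorem tendsto_maclaurin_coeff {F : ℕ → ℂ → ℂ} {f : ℂ → ℂ} {A : ℕ → ℕ → ℝ} {a : ℕ → ℝ}
    (h : TendstoLocallyUniformlyOn F f atTop Set.univ) (hF : ∀ N, Differentiable ℂ (F N))
    (hf : Differentiable ℂ f) (hA : ∀ N, HasMaclaurinCoeffs (F N) (A N))
    (ha : HasMaclaurinCoeffs f a) (n : ℕ) : Tendsto (fun N => A N n) atTop (𝓝 (a n)) := by
  have hdiff : ∀ (g : ℂ → ℂ), Differentiable ℂ g → ∀ n, Differentiable ℂ (iteratedDeriv n g) := by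
    intro g hg n
    exact (hg.contDiff (n := n + 1)).differentiable_iteratedDeriv n (by exact_mod_cast Nat.lt_succ_self n)
  -- By Weierstrass, locally uniform convergence of holomorphic functions passes to derivatives.
  have key : ∀ n, TendstoLocallyUniformlyOn (fun N => iteratedDeriv n (F N)) (iteratedDeriv n f)
      atTop Set.univ := by
    intro n
    induction n with
    | zero => simpa using h
    | succ n ih =>
      have := ih.deriv (Eventually.of_forall fun N => (hdiff _ (hF N) n).differentiableOn)
        isOpen_univ
      simpa [Function.comp_def, iteratedDeriv_succ] using this
  have h0 := ((key n).tendsto_at (Set.mem_univ (0 : ℂ))).const_mul ((n.factorial : ℂ)⁻¹)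
  have h1 := (Complex.continuous_re.tendsto _).comp h0
  have e1 : ∀ N, A N n = ((n.factorial : ℂ)⁻¹ * iteratedDeriv n (F N) 0).re := fun N => by
    rw [← (hA N).coeff_eq (hF N) n]; simp
  have e2 : a n = ((n.factorial : ℂ)⁻¹ * iteratedDeriv n f 0).re := by
    rw [← ha.coeff_eq hf n]; simp
  rw [e2]
  exact h1.congr fun N => (e1 N).symm

end Maclaurin

/-! ### Coefficientwise limits of real-rooted polynomials -/

section RealRooted
open Polynomial
open scoped PowerSeries.WithPiTopology

/-- Rolle's theorem, counted with multiplicity: differentiation loses at most one real root, and the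
degree drops by at least one. -/
theorem Polynomial.Splits.derivative_real {p : ℝ[X]} (hp : p.Splits) : p.derivative.Splits := by
  rcases Nat.eq_zero_or_pos p.natDegree with h0 | h0
  · rw [Polynomial.natDegree_eq_zero.1 h0 |>.choose_spec.symm]; simp
  rw [splits_iff_card_roots] at hp ⊢
  have h1 := Polynomial.card_roots_le_derivative p
  have h2 := Polynomial.card_roots' p.derivative
  have h3 := Polynomial.natDegree_derivative_lt h0.ne'
  omega

/-- The growth bound `|p z| ≤ |p 0| exp (Re z p'(0)/p(0) + s |z|²/2)` for real-rooted polynomials,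
where `s` is the sum of the squares of the reciprocals of the zeros. -/
theorem Polynomial.Splits.norm_aeval_le {p : ℝ[X]} (hp : p.Splits) (h0 : p.coeff 0 ≠ 0) (z : ℂ) :
    ‖aeval z p‖ ≤ |p.coeff 0| * Real.exp (z.re * (p.coeff 1 / p.coeff 0) +
      ((p.coeff 1 / p.coeff 0) ^ 2 - 2 * (p.coeff 2 / p.coeff 0)) * ‖z‖ ^ 2 / 2) := by
  induction hp using Submonoid.closure_induction with
  | mem q hq =>
    rcases hq with ⟨a, rfl⟩ | ⟨a, rfl⟩
    · simp
    · have ha : a ≠ 0 := by simpa using h0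
      -- For one linear factor the bound is `1 + u ≤ exp u` applied to the squared modulus.
      have e : ‖aeval z (X + C a)‖ ^ 2 = a ^ 2 * (1 + 2 * (z.re / a) + ‖z‖ ^ 2 / a ^ 2) := by
        rw [← Complex.normSq_eq_norm_sq, ← Complex.normSq_eq_norm_sq]
        simp [Complex.normSq_apply]
        field_simp
        ring
      have hc2 : (X + C a : ℝ[X]).coeff 2 = 0 := by simp [coeff_X]
      have hc1 : (X + C a : ℝ[X]).coeff 1 = 1 := by simp [coeff_X]
      have hc0 : (X + C a : ℝ[X]).coeff 0 = a := by simp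
      rw [hc0, hc1, hc2]
      refine (sq_le_sq₀ (norm_nonneg _) (by positivity)).1 ?_
      rw [e, mul_pow, sq_abs, ← Real.exp_nat_mul]
      refine mul_le_mul_of_nonneg_left ?_ (sq_nonneg a)
      refine le_trans ?_ (Real.add_one_le_exp _)
      apply le_of_eq
      push_cast
      field_simp
      ring
  | one => simp [coeff_one]
  | mul q r _ _ ihq ihr =>
    have hm0 : (q * r).coeff 0 = q.coeff 0 * r.coeff 0 := mul_coeff_zero q r
    have hm1 : (q * r).coeff 1 = q.coeff 0 * r.coeff 1 + q.coeff 1 * r.coeff 0 := mul_coeff_one q r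
    have hm2 : (q * r).coeff 2 = q.coeff 0 * r.coeff 2 + q.coeff 1 * r.coeff 1 +
        q.coeff 2 * r.coeff 0 := by
      rw [coeff_mul, show Finset.HasAntidiagonal.antidiagonal 2 = {(0, 2), (1, 1), (2, 0)} from rfl]
      simp [add_assoc]
    rw [hm0] at h0
    have hq0 := left_ne_zero_of_mul h0
    have hr0 := right_ne_zero_of_mul h0
    have := mul_le_mul (ihq hq0) (ihr hr0) (norm_nonneg _) (by positivity)
    rw [map_mul, norm_mul]
    refine this.trans (le_of_eq ?_)
    -- Both `p'(0)/p(0)` and `s` are additive over products, so the exponents add up exactly.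
    rw [hm0, hm1, hm2, abs_mul, mul_mul_mul_comm, ← Real.exp_add]
    congr 2
    field_simp
    ring

/-- The power series of real-rooted polynomials. -/
def realRooted : Submonoid (PowerSeries ℝ) where
  carrier := {G | ∃ p : ℝ[X], p.Splits ∧ (p : PowerSeries ℝ) = G}
  one_mem' := ⟨1, Splits.one, by simp⟩
  mul_mem' := by
    rintro _ _ ⟨p, hp, rfl⟩ ⟨q, hq, rfl⟩
    exact ⟨p * q, hp.mul hq, by simp⟩

/-- The coefficientwise closure of the set of real-rooted polynomials. -/
noncomputable def realRootedClosure : Submonoid (PowerSeries ℝ) := realRooted.topologicalClosure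

theorem mem_realRootedClosure_of_tendsto {G : ℕ → PowerSeries ℝ} {H : PowerSeries ℝ}
    (hG : ∀ N, G N ∈ realRootedClosure)
    (h : ∀ n, Tendsto (fun N => PowerSeries.coeff n (G N)) atTop (𝓝 (PowerSeries.coeff n H))) :
    H ∈ realRootedClosure :=
  (Submonoid.isClosed_topologicalClosure realRooted).mem_of_tendsto
    ((PowerSeries.WithPiTopology.tendsto_iff_coeff_tendsto ..).2 h) (Eventually.of_forall hG)

theorem coe_mem_realRootedClosure {p : ℝ[X]} (hp : p.Splits) :
    (p : PowerSeries ℝ) ∈ realRootedClosure :=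
  Submonoid.le_topologicalClosure _ ⟨p, hp, rfl⟩

theorem continuous_derivative : Continuous (PowerSeries.derivative ℝ) := by
  rw [continuous_iff_continuousAt]
  intro G
  refine (PowerSeries.WithPiTopology.tendsto_iff_coeff_tendsto ..).2 fun n => ?_
  simp only [PowerSeries.coeff_derivative]
  exact ((PowerSeries.WithPiTopology.continuous_coeff ℝ (n + 1)).tendsto G).mul_const _

theorem derivative_mem_realRootedClosure {G : PowerSeries ℝ} (hG : G ∈ realRootedClosure) :
    PowerSeries.derivative ℝ G ∈ realRootedClosure := by
  refine map_mem_closure continuous_derivative hG ?_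
  rintro _ ⟨p, hp, rfl⟩
  exact ⟨p.derivative, hp.derivative_real, (PowerSeries.derivative_coe p).symm⟩

/-- For real-rooted approximants, the sum of the reciprocal zeros and the sum of their squares tend
to 0. The growth bound on the circle of radius `R` then tends to the modulus of the constant term,
for every `R`, and Cauchy's estimate forces `G` to be constant. -/
theorem coeff_eq_zero_of_mem_realRootedClosure {G : PowerSeries ℝ} (hG : G ∈ realRootedClosure)
    (h0 : PowerSeries.coeff 0 G ≠ 0) (h1 : PowerSeries.coeff 1 G = 0)
    (h2 : PowerSeries.coeff 2 G = 0) {j : ℕ} (hj : j ≠ 0) : PowerSeries.coeff j G = 0 := by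
  have key : ∀ R : ℝ, 0 < R → |PowerSeries.coeff j G| * R ^ j ≤ |PowerSeries.coeff 0 G| := by
    intro R hR
    have hne : (𝓝[(realRooted : Set (PowerSeries ℝ))] G).NeBot :=
      mem_closure_iff_nhdsWithin_neBot.1 hG
    have hc : ∀ n, Tendsto (fun H : PowerSeries ℝ => PowerSeries.coeff n H)
        (𝓝[(realRooted : Set (PowerSeries ℝ))] G) (𝓝 (PowerSeries.coeff n G)) := fun n =>
      ((PowerSeries.WithPiTopology.continuous_coeff ℝ n).tendsto G).mono_left nhdsWithin_le_nhds
    have hl : Tendsto (fun H : PowerSeries ℝ => |PowerSeries.coeff j H| * R ^ j)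
        (𝓝[(realRooted : Set (PowerSeries ℝ))] G) (𝓝 (|PowerSeries.coeff j G| * R ^ j)) :=
      (hc j).abs.mul_const _
    have hr : Tendsto (fun H : PowerSeries ℝ => |PowerSeries.coeff 0 H| *
        Real.exp (R * |PowerSeries.coeff 1 H / PowerSeries.coeff 0 H| +
          ((PowerSeries.coeff 1 H / PowerSeries.coeff 0 H) ^ 2 -
            2 * (PowerSeries.coeff 2 H / PowerSeries.coeff 0 H)) * R ^ 2 / 2))
        (𝓝[(realRooted : Set (PowerSeries ℝ))] G) (𝓝 (|PowerSeries.coeff 0 G| *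
        Real.exp (R * |PowerSeries.coeff 1 G / PowerSeries.coeff 0 G| +
          ((PowerSeries.coeff 1 G / PowerSeries.coeff 0 G) ^ 2 -
            2 * (PowerSeries.coeff 2 G / PowerSeries.coeff 0 G)) * R ^ 2 / 2))) := by
      have q1 := (hc 1).div (hc 0) h0
      have q2 := (hc 2).div (hc 0) h0
      exact (hc 0).abs.mul ((((q1.abs.const_mul R).add
        ((((q1.pow 2).sub (q2.const_mul 2)).mul_const (R ^ 2)).div_const 2))).rexp)
    have hle := le_of_tendsto_of_tendsto hl hr (by
      filter_upwards [self_mem_nhdsWithin, (hc 0).eventually_ne h0] with H hH hH0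
      obtain ⟨p, hp, rfl⟩ := hH
      simp only [Polynomial.coeff_coe] at hH0 ⊢
      have hB := (hasMaclaurinCoeffs_polynomial p).abs_coeff_mul_pow_le
        (Polynomial.differentiable_aeval p) hR (B := |p.coeff 0| *
        Real.exp (R * |p.coeff 1 / p.coeff 0| +
          ((p.coeff 1 / p.coeff 0) ^ 2 - 2 * (p.coeff 2 / p.coeff 0)) * R ^ 2 / 2)) (fun z hz => by
          refine (hp.norm_aeval_le hH0 z).trans ?_
          rw [hz]
          refine mul_le_mul_of_nonneg_left (Real.exp_le_exp.2 (add_le_add ?_ le_rfl))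
            (abs_nonneg _)
          calc z.re * (p.coeff 1 / p.coeff 0) ≤ |z.re * (p.coeff 1 / p.coeff 0)| := le_abs_self _
            _ = |z.re| * |p.coeff 1 / p.coeff 0| := abs_mul _ _
            _ ≤ _ := by
              gcongr
              exact (Complex.abs_re_le_norm z).trans hz.le) j
      simpa using hB)
    simpa [h1, h2] using hle
  by_contra hne
  have hpos : 0 < |PowerSeries.coeff j G| := abs_pos.2 hne
  have h0' : 0 < |PowerSeries.coeff 0 G| := abs_pos.2 h0
  have hlim : Tendsto (fun R : ℝ => |PowerSeries.coeff j G| * R ^ j) atTop atTop :=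
    (tendsto_pow_atTop hj).const_mul_atTop hpos
  obtain ⟨R, hR1, hR2⟩ := ((hlim.eventually_gt_atTop |PowerSeries.coeff 0 G|).and
    (eventually_gt_atTop 0)).exists
  exact absurd (key R hR2) (not_le.2 hR1)

/-- Two consecutive vanishing coefficients force all later coefficients to vanish. -/
theorem coeff_eq_zero_of_consecutive {G : PowerSeries ℝ} (hG : G ∈ realRootedClosure)
    (h0 : PowerSeries.coeff 0 G ≠ 0) {m : ℕ} (h1 : PowerSeries.coeff m G = 0)
    (h2 : PowerSeries.coeff (m + 1) G = 0) {j : ℕ} (hj : m ≤ j) : PowerSeries.coeff j G = 0 := by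
  classical
  -- The last nonzero coefficient before the gap. The `k`-th derivative has nonzero constant term
  -- and vanishing coefficients of index 1 and 2, and it is still a limit of real-rooted
  -- polynomials.
  set k := Nat.findGreatest (fun i => PowerSeries.coeff i G ≠ 0) m with hk
  have hk0 : PowerSeries.coeff k G ≠ 0 :=
    Nat.findGreatest_spec (P := fun i => PowerSeries.coeff i G ≠ 0) (Nat.zero_le m) h0
  have hkm : k < m := lt_of_le_of_ne (Nat.findGreatest_le m) fun h => hk0 (h ▸ h1)
  have hz : ∀ i, k < i → i ≤ m + 1 → PowerSeries.coeff i G = 0 := by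
    intro i hi him
    rcases Nat.lt_or_ge m i with h | h
    · rwa [show i = m + 1 by omega]
    · by_contra hne
      exact Nat.findGreatest_is_greatest hi h hne
  have hmem : ∀ n, (PowerSeries.derivative ℝ)^[n] G ∈ realRootedClosure := by
    intro n
    induction n with
    | zero => exact hG
    | succ n ih =>
      rw [Function.iterate_succ_apply']
      exact derivative_mem_realRootedClosure ih
  have hcoeff : ∀ n i, PowerSeries.coeff i ((PowerSeries.derivative ℝ)^[n] G) = 0 ↔
      PowerSeries.coeff (i + n) G = 0 := by
    intro n
    induction n with
    | zero => simp
    | succ n ih =>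
      intro i
      rw [Function.iterate_succ_apply', PowerSeries.coeff_derivative, mul_eq_zero, ih,
        show i + 1 + n = i + (n + 1) by ring]
      have : (i : ℝ) + 1 ≠ 0 := by positivity
      simp [this]
  have := coeff_eq_zero_of_mem_realRootedClosure (hmem k)
    (by rw [ne_eq, hcoeff]; simpa using hk0)
    ((hcoeff _ _).2 (hz _ (by omega) (by omega))) ((hcoeff _ _).2 (hz _ (by omega) (by omega)))
    (j := j - k) (by omega)
  rw [hcoeff] at this
  rwa [show j - k + k = j by omega] at this

/-- Coefficientwise form of `(1 + c z / N)^N → exp (c z)`. -/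
theorem tendsto_choose_mul_div_pow (c : ℝ) (i : ℕ) :
    Tendsto (fun N : ℕ => (N.choose i : ℝ) * (c / N) ^ i) atTop (𝓝 (c ^ i / (i.factorial : ℝ))) := by
  have h := (Asymptotics.isEquivalent_iff_tendsto_one (by
    filter_upwards [eventually_gt_atTop 0] with N hN
    positivity)).1 (isEquivalent_choose i)
  have h2 := h.mul_const (c ^ i / (i.factorial : ℝ))
  rw [one_mul] at h2
  refine h2.congr' ?_
  filter_upwards [eventually_gt_atTop 0] with N hN
  simp only [Pi.div_apply, div_pow]
  field_simp

theorem splits_one_add_C_mul_X (b : ℝ) : (1 + C b * X : ℝ[X]).Splits :=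
  Splits.of_natDegree_le_one (by
    refine (natDegree_add_le _ _).trans (max_le (by simp) (by simpa using natDegree_C_mul_X_pow_le b 1)))

theorem coeff_comp_one_add_X_pow (b : ℝ) (N n : ℕ) :
    (((1 + X) ^ N : ℝ[X]).comp (C b * X)).coeff n = N.choose n * b ^ n := by
  rw [comp_C_mul_X_coeff, coeff_one_add_X_pow]

theorem expLinear_mem_realRootedClosure (c : ℝ) : expLinear c ∈ realRootedClosure := by
  refine mem_realRootedClosure_of_tendsto
    (G := fun N => (((1 + X) ^ N : ℝ[X]).comp (C (c / N) * X) : ℝ[X]))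
    (fun N => coe_mem_realRootedClosure ?_) fun n => ?_
  · simpa using (splits_one_add_C_mul_X (c / N)).pow N
  · simp only [Polynomial.coeff_coe, coeff_comp_one_add_X_pow, expLinear, PowerSeries.coeff_mk]
    exact tendsto_choose_mul_div_pow c n

theorem expSq_mem_realRootedClosure {a : ℝ} (ha : a < 0) : expSq a ∈ realRootedClosure := by
  refine mem_realRootedClosure_of_tendsto
    (G := fun N => (expand ℝ 2 (((1 + X) ^ N : ℝ[X]).comp (C (a / N) * X)) : ℝ[X]))
    (fun N => coe_mem_realRootedClosure ?_) fun n => ?_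
  -- The approximant `(1 + a z² / N)^N` of `exp (a z²)` is real-rooted because `a < 0`.
  · have h : expand ℝ 2 (((1 + X) ^ N : ℝ[X]).comp (C (a / N) * X)) =
        ((1 + C √(-(a / N)) * X) * (1 + C (-√(-(a / N))) * X)) ^ N := by
      have hs : √(-(a / N)) * √(-(a / N)) = -(a / N) :=
        Real.mul_self_sqrt (neg_nonneg.2 (div_nonpos_of_nonpos_of_nonneg ha.le N.cast_nonneg))
      have hs2 : (C √(-(a / N)) * C √(-(a / N)) : ℝ[X]) = - C (a / N) := by
        rw [← C_mul, hs, C_neg]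
      simp only [pow_comp, add_comp, one_comp, X_comp, map_pow, map_add, map_one, map_mul,
        expand_C, expand_X, C_neg]
      congr 1
      linear_combination (X ^ 2) * hs2
    rw [h]
    exact ((splits_one_add_C_mul_X _).mul (splits_one_add_C_mul_X _)).pow N
  · simp only [Polynomial.coeff_coe, coeff_expand two_pos, coeff_comp_one_add_X_pow, expSq,
      PowerSeries.coeff_mk]
    split_ifs
    · exact tendsto_choose_mul_div_pow a (n / 2)
    · exact tendsto_const_nhds

end RealRooted

/-! ### Canonical products as limits of real-rooted polynomials -/

section Series
variable {l : ℕ} {x : ℕ → ℝ} {δ : ℝ}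

theorem exists_realRootedClosure_zeroFactor (l : ℕ) (t : ℝ) :
    ∃ G ∈ realRootedClosure, HasMaclaurinCoeffs (zeroFactor l t)
      fun n => PowerSeries.coeff n G := by
  refine ⟨((1 + Polynomial.C (-t⁻¹) * Polynomial.X : Polynomial ℝ) : PowerSeries ℝ) *
    expLinear (l / t), mul_mem (coe_mem_realRootedClosure (splits_one_add_C_mul_X _))
      (expLinear_mem_realRootedClosure _), ?_⟩
  have h := (hasMaclaurinCoeffs_polynomial (1 + Polynomial.C (-t⁻¹) * Polynomial.X)).mul
    (hasMaclaurinCoeffs_expLinear (l / t))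
  have e : (fun z : ℂ => (Polynomial.aeval z) (1 + Polynomial.C (-t⁻¹) * Polynomial.X) *
      Complex.exp (((l / t : ℝ) : ℂ) * z)) = zeroFactor l t := by
    funext z
    simp only [map_add, map_one, map_mul, Polynomial.aeval_C, Polynomial.aeval_X, zeroFactor,
      Complex.coe_algebraMap]
    push_cast
    ring_nf
  rwa [e] at h

theorem exists_realRootedClosure_canonicalProduct (hl : l = 0 ∨ l = 1) (hδ : 0 < δ)
    (hx : ∀ n, δ ≤ x n) (hs : Summable fun n => (x n ^ (l + 1))⁻¹) :
    ∃ G ∈ realRootedClosure, HasMaclaurinCoeffs (canonicalProduct l x)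
      fun n => PowerSeries.coeff n G := by
  have hpart : ∀ N : ℕ, ∃ G ∈ realRootedClosure,
      HasMaclaurinCoeffs (fun z => ∏ n ∈ Finset.range N, zeroFactor l (x n) z)
        fun n => PowerSeries.coeff n G := by
    intro N
    induction N with
    | zero =>
      refine ⟨1, one_mem _, ?_⟩
      simpa using hasMaclaurinCoeffs_polynomial 1
    | succ N ih =>
      obtain ⟨G, hG, hG'⟩ := ih
      obtain ⟨H, hH, hH'⟩ := exists_realRootedClosure_zeroFactor l (x N)
      refine ⟨G * H, mul_mem hG hH, ?_⟩
      simpa only [Finset.prod_range_succ] using hG'.mul hH'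
  choose G hG hG' using hpart
  have hd := differentiable_canonicalProduct hl hδ hx hs
  obtain ⟨H, hH⟩ := exists_hasMaclaurinCoeffs hd (canonicalProduct_conj hl hδ hx hs)
  refine ⟨H, mem_realRootedClosure_of_tendsto hG fun n => ?_, hH⟩
  exact tendsto_maclaurin_coeff (tendstoLocallyUniformlyOn_canonicalProduct hl hδ hx hs)
    (fun N => Differentiable.fun_finsetProd fun n _ => differentiable_zeroFactor l (x n)) hd hG' hH n

theorem tendsto_atTop_of_summable_inv_pow {k : ℕ} (hx : ∀ n, 0 < x n)
    (hs : Summable fun n => (x n ^ k)⁻¹) : Tendsto x atTop atTop := by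
  have h := hs.tendsto_atTop_zero
  refine tendsto_atTop.2 fun M => ?_
  have hM : (0 : ℝ) < (max M 1) ^ k := by positivity
  filter_upwards [h.eventually_lt_const (inv_pos.2 hM)] with n hn
  by_contra! hlt
  have : x n ≤ max M 1 := hlt.le.trans (le_max_left _ _)
  exact absurd hn (not_lt.2 (inv_anti₀ (pow_pos (hx n) k) (pow_le_pow_left₀ (hx n).le this k)))

/-- An entire function with infinitely many zeros is not a polynomial. -/
theorem exists_coeff_ne_zero_of_infinite_zeros {f : ℂ → ℂ} {a : ℕ → ℝ}
    (ha : HasMaclaurinCoeffs f a) (h0 : a 0 ≠ 0) (hinf : {z | f z = 0}.Infinite) (m : ℕ) :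
    ∃ n ≥ m, a n ≠ 0 := by
  by_contra! h
  set p : Polynomial ℂ := ∑ n ∈ Finset.range m, Polynomial.monomial n (a n : ℂ) with hp
  have hval : ∀ z, p.eval z = f z := by
    intro z
    have := hasSum_sum_of_ne_finset_zero (L := .unconditional ℕ) (f := fun n => (a n : ℂ) * z ^ n)
      (s := Finset.range m) fun n hn => by rw [h n (by simpa using hn)]; simp
    rw [← this.unique (ha z), hp, Polynomial.eval_finsetSum]
    simp
  have hp0 : p = 0 := Polynomial.eq_zero_of_infinite_isRoot p (hinf.mono fun z hz => by
    simpa [Polynomial.IsRoot, hval] using hz)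
  have hm : 0 < m := by
    by_contra hm
    exact h0 (h 0 (by omega))
  have hc : p.coeff 0 = a 0 := by
    rw [hp, Polynomial.finsetSum_coeff, Finset.sum_eq_single 0]
    · simp
    · intro b _ hb; simp [Polynomial.coeff_monomial, hb]
    · intro h; simp at h; omega
  rw [hp0, Polynomial.coeff_zero] at hc
  exact h0 (by exact_mod_cast hc.symm)

theorem HasMaclaurinCoeffs.coeff_zero {f : ℂ → ℂ} {a : ℕ → ℝ} (ha : HasMaclaurinCoeffs f a) :
    (a 0 : ℂ) = f 0 := by
  have h := hasSum_single (L := .unconditional ℕ) (f := fun n => (a n : ℂ) * 0 ^ n) 0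
    fun n hn => by simp [hn]
  simpa using h.unique (ha 0)

/-- Otherwise the function would be a polynomial, although it has infinitely many zeros. The factor
`exp (c z)` accommodates the exponential part contributed by the prepended zeros when the genus is
1. -/
theorem not_consecutive_coeff_eq_zero (hl : l = 0 ∨ l = 1) (hδ : 0 < δ)
    (hx : ∀ n, δ ≤ x n) (hs : Summable fun n => (x n ^ (l + 1))⁻¹) {G : PowerSeries ℝ}
    (hG : HasMaclaurinCoeffs (canonicalProduct l x) fun n => PowerSeries.coeff n G)
    (c : ℝ) {a : ℝ} (ha : a < 0) (n : ℕ) :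
    ¬ (PowerSeries.coeff n (expSq a * (expLinear c * G)) = 0 ∧
      PowerSeries.coeff (n + 1) (expSq a * (expLinear c * G)) = 0) := by
  rintro ⟨h1, h2⟩
  obtain ⟨G', hG', hG''⟩ := exists_realRootedClosure_canonicalProduct hl hδ hx hs
  obtain rfl : G' = G := PowerSeries.ext fun n => congrFun (hG''.unique hG) n
  have hmem : expSq a * (expLinear c * G') ∈ realRootedClosure :=
    mul_mem (expSq_mem_realRootedClosure ha) (mul_mem (expLinear_mem_realRootedClosure c) hG')
  have hm := (hasMaclaurinCoeffs_expSq a).mul ((hasMaclaurinCoeffs_expLinear c).mul hG)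
  have h0 : PowerSeries.coeff 0 (expSq a * (expLinear c * G')) ≠ 0 := by
    have := hm.coeff_zero
    simp only [canonicalProduct_zero] at this
    intro h
    rw [h] at this
    simp at this
  have hinf : {z : ℂ | Complex.exp (a * z ^ 2) * (Complex.exp (c * z) *
      canonicalProduct l x z) = 0}.Infinite := by
    have hx0 : ∀ n, 0 < x n := fun n => hδ.trans_le (hx n)
    have ht := tendsto_atTop_of_summable_inv_pow hx0 hs
    have hr : (Set.range x).Infinite := fun hf => by
      obtain ⟨M, hM⟩ := hf.bddAbove
      obtain ⟨n, hn⟩ := (ht.eventually_gt_atTop M).exists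
      exact absurd (hM ⟨n, rfl⟩) (not_le.2 hn)
    refine (hr.image Complex.ofReal_injective.injOn).mono ?_
    rintro _ ⟨_, ⟨n, rfl⟩, rfl⟩
    simp [canonicalProduct_apply_zero hl hδ hx hs n]
  obtain ⟨j, hj, hj'⟩ := exists_coeff_ne_zero_of_infinite_zeros hm h0 hinf n
  exact hj' (coeff_eq_zero_of_consecutive hmem h0 h1 h2 hj)

end Series

/-! ### Generic choice of the two free parameters -/

section Generic
open Polynomial

/-- The Maclaurin coefficients of `exp (a z²) E z` as polynomials in `a`. -/
noncomputable def expSqCoeff (E : PowerSeries ℝ) (n : ℕ) : ℝ[X] :=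
  ∑ p ∈ Finset.HasAntidiagonal.antidiagonal n,
    (if 2 ∣ p.1 then C (PowerSeries.coeff p.2 E / ((p.1 / 2).factorial : ℝ)) * X ^ (p.1 / 2) else 0)

theorem eval_expSqCoeff (E : PowerSeries ℝ) (n : ℕ) (a : ℝ) :
    (expSqCoeff E n).eval a = PowerSeries.coeff n (expSq a * E) := by
  rw [expSqCoeff, eval_finsetSum, PowerSeries.coeff_mul]
  refine Finset.sum_congr rfl fun p _ => ?_
  by_cases h : 2 ∣ p.1
  · simp [expSq, h]; ring
  · simp [expSq, h]

theorem natDegree_expSqCoeff_le (E : PowerSeries ℝ) (n : ℕ) :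
    (expSqCoeff E n).natDegree ≤ n / 2 := by
  refine natDegree_sum_le_of_forall_le _ _ fun p hp => ?_
  have hp' : p.1 + p.2 = n := by simpa using hp
  split_ifs
  · exact (natDegree_C_mul_X_pow_le _ _).trans (by omega)
  · simp

/-- With the degree bound `n / 2`, this is the leading coefficient when `E` has nonzero constant
term; only the top term of `exp (a z²)` reaches degree `k` in `a`. -/
theorem coeff_expSqCoeff (E : PowerSeries ℝ) (k : ℕ) :
    (expSqCoeff E (2 * k)).coeff k = PowerSeries.coeff 0 E / (k.factorial : ℝ) := by
  rw [expSqCoeff, finsetSum_coeff, Finset.sum_eq_single (2 * k, 0)]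
  · simp
  · rintro ⟨i, j⟩ hp hne
    have hp' : i + j = 2 * k := by simpa using hp
    split_ifs with h
    · have : k ≠ i / 2 := by
        rintro rfl
        exact hne (by ext <;> simp <;> omega)
      simp [coeff_X_pow, this]
    · simp
  · intro h; simp at h

/-- For all but countably many `e₃` and, given `e₃`, for all but countably many `e₂`, at most one
of the coefficients of even index of `exp (a z²) (1 - s z + e₂ z² - e₃ z³) E z` vanishes. -/
theorem exists_generic_parameters {E : PowerSeries ℝ} (hE : PowerSeries.coeff 0 E = 1)
    (hgap : ∀ a < 0, ∀ n, ¬ ((expSqCoeff E n).eval a = 0 ∧ (expSqCoeff E (n + 1)).eval a = 0))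
    (s : ℝ) {u₂ v₂ u₃ v₃ : ℝ} (h₂ : u₂ < v₂) (h₃ : u₃ < v₃) :
    ∃ e₂ ∈ Set.Ioo u₂ v₂, ∃ e₃ ∈ Set.Ioo u₃ v₃, ∀ a < 0, ∀ k m : ℕ, 2 ≤ k → 2 ≤ m → k ≠ m →
      ¬ (((expSqCoeff E (2 * k)).eval a - s * (expSqCoeff E (2 * k - 1)).eval a
          + e₂ * (expSqCoeff E (2 * k - 2)).eval a - e₃ * (expSqCoeff E (2 * k - 3)).eval a = 0) ∧
        ((expSqCoeff E (2 * m)).eval a - s * (expSqCoeff E (2 * m - 1)).eval a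
          + e₂ * (expSqCoeff E (2 * m - 2)).eval a - e₃ * (expSqCoeff E (2 * m - 3)).eval a = 0)) := by
  set F := expSqCoeff E with hF
  have hF0 : ∀ k, F (2 * k) ≠ 0 := fun k h => by
    have := coeff_expSqCoeff E k
    rw [← hF, h, hE] at this
    have h2 : (k.factorial : ℝ) ≠ 0 := by positivity
    simp at this
    exact h2 this.symm
  -- The values of `e₃` that make the coefficient of index `2k` vanish at an `a` where the factor `F
  -- (2k - 2)` of `e₂` is zero.
  set bad₃ : Set ℝ := ⋃ k : ℕ, ⋃ a ∈ (F (2 * k - 2)).roots.toFinset,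
    {((F (2 * k)).eval a - s * (F (2 * k - 1)).eval a) / (F (2 * k - 3)).eval a} with hbad₃
  have hc₃ : bad₃.Countable := Set.countable_iUnion fun k =>
    Set.Countable.biUnion (Finset.countable_toSet _) fun a _ => Set.countable_singleton _
  obtain ⟨e₃, he₃, hn₃⟩ : ∃ e₃ ∈ Set.Ioo u₃ v₃, e₃ ∉ bad₃ := by
    by_contra! h
    exact (Cardinal.Real.Ioo_countable_iff.not.2 (not_le.2 h₃)) (hc₃.mono h)
  set H : ℕ → ℝ[X] := fun k => F (2 * k) - C s * F (2 * k - 1) - C e₃ * F (2 * k - 3) with hH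
  -- The result of eliminating `e₂` from `H k + e₂ F (2k - 2) = 0` and `H m + e₂ F (2m - 2) = 0`.
  set D : ℕ → ℕ → ℝ[X] := fun k m => H k * F (2 * m - 2) - H m * F (2 * k - 2) with hD
  have hHdeg : ∀ k, 1 ≤ k → (H k).natDegree ≤ k := fun k hk => by
    have h1 := natDegree_expSqCoeff_le E (2 * k)
    have h2 := natDegree_expSqCoeff_le E (2 * k - 1)
    have h3 := natDegree_expSqCoeff_le E (2 * k - 3)
    rw [← hF] at h1 h2 h3
    refine (natDegree_sub_le _ _).trans (max_le ((natDegree_sub_le _ _).trans (max_le ?_ ?_)) ?_)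
    · omega
    · exact (natDegree_C_mul_le _ _).trans (by omega)
    · exact (natDegree_C_mul_le _ _).trans (by omega)
  have hHc : ∀ k, 1 ≤ k → (H k).coeff k = 1 / (k.factorial : ℝ) := fun k hk => by
    have h2 := natDegree_expSqCoeff_le E (2 * k - 1)
    have h3 := natDegree_expSqCoeff_le E (2 * k - 3)
    rw [← hF] at h2 h3
    have c1 := coeff_expSqCoeff E k
    rw [← hF, hE] at c1
    simp only [hH, coeff_sub, coeff_C_mul, c1]
    rw [coeff_eq_zero_of_natDegree_lt (p := F (2 * k - 1)) (by omega),
      coeff_eq_zero_of_natDegree_lt (p := F (2 * k - 3)) (by omega)]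
    ring
  have hDne : ∀ k m, 2 ≤ k → 2 ≤ m → k ≠ m → D k m ≠ 0 := by
    intro k m hk hm hkm h
    have hF2 : ∀ m, 2 ≤ m → (F (2 * m - 2)).natDegree ≤ m - 1 := fun m hm => by
      have := natDegree_expSqCoeff_le E (2 * m - 2)
      rw [← hF] at this
      omega
    have hFc : ∀ m, 2 ≤ m → (F (2 * m - 2)).coeff (m - 1) = 1 / ((m - 1).factorial : ℝ) :=
      fun m hm => by
        have := coeff_expSqCoeff E (m - 1)
        rwa [hE, ← hF, show 2 * (m - 1) = 2 * m - 2 by omega] at this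
    have h1 := coeff_mul_add_eq_of_natDegree_le (hHdeg k (by omega)) (hF2 m hm)
    have h2 := coeff_mul_add_eq_of_natDegree_le (hHdeg m (by omega)) (hF2 k hk)
    rw [hHc _ (by omega), hFc _ hm] at h1
    rw [hHc _ (by omega), hFc _ hk, show m + (k - 1) = k + (m - 1) by omega] at h2
    -- The coefficient of degree `k + m - 1` in `D k m` is `1/(k! (m-1)!) - 1/(m! (k-1)!) = (m -
    -- k)/(k! m!)`, nonzero for `k ≠ m`.
    have h3 := congrArg (fun p => p.coeff (k + (m - 1))) h
    simp only [hD, coeff_sub, coeff_zero, h1, h2] at h3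
    obtain ⟨k, rfl⟩ : ∃ j, k = j + 1 := ⟨k - 1, by omega⟩
    obtain ⟨m, rfl⟩ : ∃ j, m = j + 1 := ⟨m - 1, by omega⟩
    simp only [Nat.add_sub_cancel, Nat.factorial_succ] at h3
    push_cast at h3
    have f1 : (k.factorial : ℝ) ≠ 0 := by positivity
    have f2 : (m.factorial : ℝ) ≠ 0 := by positivity
    have f3 : (k : ℝ) + 1 ≠ 0 := by positivity
    have f4 : (m : ℝ) + 1 ≠ 0 := by positivity
    field_simp at h3
    apply hkm
    have : (m : ℝ) = k := by linarith
    have : m = k := by exact_mod_cast this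
    rw [this]
  set bad₂ : Set ℝ := ⋃ k : ℕ, ⋃ m : ℕ, ⋃ a ∈ (D k m).roots.toFinset,
    {-(H k).eval a / (F (2 * k - 2)).eval a} with hbad₂
  have hc₂ : bad₂.Countable := Set.countable_iUnion fun k => Set.countable_iUnion fun m =>
    Set.Countable.biUnion (Finset.countable_toSet _) fun a _ => Set.countable_singleton _
  obtain ⟨e₂, he₂, hn₂⟩ : ∃ e₂ ∈ Set.Ioo u₂ v₂, e₂ ∉ bad₂ := by
    by_contra! h
    exact (Cardinal.Real.Ioo_countable_iff.not.2 (not_le.2 h₂)) (hc₂.mono h)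
  refine ⟨e₂, he₂, e₃, he₃, fun a ha k m hk hm hkm ⟨h1, h2⟩ => ?_⟩
  have hHe : ∀ k, (H k).eval a = (F (2 * k)).eval a - s * (F (2 * k - 1)).eval a
      - e₃ * (F (2 * k - 3)).eval a := fun k => by simp [hH]
  have h1' : (H k).eval a + e₂ * (F (2 * k - 2)).eval a = 0 := by rw [hHe]; linarith
  have h2' : (H m).eval a + e₂ * (F (2 * m - 2)).eval a = 0 := by rw [hHe]; linarith
  have hDa : (D k m).eval a = 0 := by
    simp only [hD, eval_sub, eval_mul]
    linear_combination (F (2 * m - 2)).eval a * h1' - (F (2 * k - 2)).eval a * h2'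
  -- If `e₂` drops out, `hgap` gives `F (2k - 3) ≠ 0` at `a`, so the equation determines `e₃`;
  -- otherwise it determines `e₂`.
  by_cases hFk : (F (2 * k - 2)).eval a = 0
  · have hFk3 : (F (2 * k - 3)).eval a ≠ 0 := fun h3 =>
      hgap a ha (2 * k - 3) ⟨h3, by rwa [show 2 * k - 3 + 1 = 2 * k - 2 by omega]⟩
    refine hn₃ (Set.mem_iUnion.2 ⟨k, Set.mem_biUnion (x := a) ?_ ?_⟩)
    · have := hF0 (k - 1)
      rw [show 2 * (k - 1) = 2 * k - 2 by omega] at this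
      simpa [this, IsRoot] using hFk
    · rw [Set.mem_singleton_iff, eq_div_iff hFk3]
      rw [hHe, hFk] at h1'
      linarith
  · refine hn₂ (Set.mem_iUnion.2 ⟨k, Set.mem_iUnion.2 ⟨m, Set.mem_biUnion (x := a) ?_ ?_⟩⟩)
    · simpa [hDne k m hk hm hkm, IsRoot] using hDa
    · rw [Set.mem_singleton_iff, eq_div_iff hFk]
      linarith

end Generic

/-! ### The argument of a canonical product on the imaginary axis -/

section Phase

/-- Polar form, from `1 - i w = √(1 + w²) exp (-i arctan w)` with `w = y / t`. -/
theorem zeroFactor_I_mul (l : ℕ) (t y : ℝ) :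
    zeroFactor l t (Complex.I * y) = (√(1 + (y / t) ^ 2) : ℝ) *
      Complex.exp (((l * (y / t) - Real.arctan (y / t) : ℝ) : ℂ) * Complex.I) := by
  set w := y / t with hw
  have hpos : (0 : ℝ) < √(1 + w ^ 2) := by positivity
  have h1 : Complex.I * (y : ℂ) / (t : ℂ) = w * Complex.I := by rw [hw]; push_cast; ring
  have h2 : (1 - w * Complex.I : ℂ) = (√(1 + w ^ 2) : ℝ) *
      Complex.exp (((-Real.arctan w : ℝ) : ℂ) * Complex.I) := by
    rw [Complex.exp_mul_I, ← Complex.ofReal_cos, ← Complex.ofReal_sin, Real.cos_neg, Real.sin_neg,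
      Real.cos_arctan, Real.sin_arctan]
    apply Complex.ext
    · simp; field_simp
    · simp; field_simp
  rw [zeroFactor, h1, h2, mul_assoc, ← Complex.exp_add]
  congr 2
  rw [mul_div_assoc, h1]
  push_cast
  ring

theorem arctan_le_self {w : ℝ} (hw : 0 ≤ w) : Real.arctan w ≤ w := by
  calc Real.arctan w ≤ Real.tan (Real.arctan w) := by
        rcases hw.eq_or_lt with rfl | h
        · simp
        · exact (Real.lt_tan (Real.arctan_pos.2 h) (Real.arctan_lt_pi_div_two w)).le
    _ = w := Real.tan_arctan w

theorem self_sub_sq_le_arctan {w : ℝ} (hw : 0 ≤ w) : w - w ^ 2 ≤ Real.arctan w := by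
  have h1 : Real.sin (Real.arctan w) ≤ Real.arctan w := Real.sin_le (Real.arctan_nonneg.2 hw)
  rw [Real.sin_arctan] at h1
  refine le_trans ?_ h1
  have h2 : √(1 + w ^ 2) ≤ 1 + w := by
    rw [Real.sqrt_le_left (by positivity)]; nlinarith
  have h3 : w / (1 + w) ≤ w / √(1 + w ^ 2) := by gcongr
  refine le_trans ?_ h3
  rw [le_div_iff₀ (by positivity)]
  nlinarith [mul_nonneg (mul_nonneg hw hw) hw]

/-- The absolute value of the argument of the factor `(1 - i w) exp (i l w)`. -/
noncomputable def absPhase (l : ℕ) (w : ℝ) : ℝ := (-1) ^ (l + 1) * (l * w - Real.arctan w)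

variable {l : ℕ} {x : ℕ → ℝ} {δ : ℝ}

theorem absPhase_nonneg (hl : l = 0 ∨ l = 1) {w : ℝ} (hw : 0 ≤ w) : 0 ≤ absPhase l w := by
  rcases hl with rfl | rfl
  · simpa [absPhase] using hw
  · simpa [absPhase] using arctan_le_self hw

theorem absPhase_le (hl : l = 0 ∨ l = 1) {w : ℝ} (hw : 0 ≤ w) : absPhase l w ≤ w ^ (l + 1) := by
  rcases hl with rfl | rfl
  · simpa [absPhase] using arctan_le_self hw
  · have := self_sub_sq_le_arctan hw
    simp [absPhase]
    linarith

/-- The constant lies below both `π/4` (genus 0) and `2 - π/2` (genus 1). Only a uniform positive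
lower bound matters. -/
theorem le_absPhase (hl : l = 0 ∨ l = 1) {w : ℝ} (hw : 2 ≤ w) : 2 / 5 ≤ absPhase l w := by
  have hpi := Real.pi_gt_three
  have hpi' := Real.pi_lt_d2
  rcases hl with rfl | rfl
  · have : Real.arctan 1 ≤ Real.arctan w := Real.arctan_strictMono.monotone (by linarith)
    rw [Real.arctan_one] at this
    simp [absPhase]
    linarith
  · have := Real.arctan_lt_pi_div_two w
    simp [absPhase]
    norm_num at hpi'
    linarith

theorem continuous_absPhase (l : ℕ) : Continuous (absPhase l) := by
  unfold absPhase
  exact continuous_const.mul ((continuous_const.mul continuous_id).sub Real.continuous_arctan)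

/-- The absolute value of a continuous argument of a canonical product on the imaginary axis. -/
noncomputable def totalPhase (l : ℕ) (x : ℕ → ℝ) (y : ℝ) : ℝ := ∑' n, absPhase l (y / x n)

theorem summable_absPhase (hl : l = 0 ∨ l = 1) (hx : ∀ n, 0 < x n)
    (hs : Summable fun n => (x n ^ (l + 1))⁻¹) {y : ℝ} (hy : 0 ≤ y) :
    Summable fun n => absPhase l (y / x n) := by
  refine Summable.of_nonneg_of_le (fun n => absPhase_nonneg hl (div_nonneg hy (hx n).le))
    (fun n => absPhase_le hl (div_nonneg hy (hx n).le)) ?_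
  simpa [mul_pow, div_eq_mul_inv] using hs.mul_left (y ^ (l + 1))

theorem continuousOn_totalPhase (hl : l = 0 ∨ l = 1) (hx : ∀ n, 0 < x n)
    (hs : Summable fun n => (x n ^ (l + 1))⁻¹) (R : ℝ) :
    ContinuousOn (totalPhase l x) (Set.Icc 0 R) := by
  refine continuousOn_tsum (u := fun n => R ^ (l + 1) * (x n ^ (l + 1))⁻¹)
    (fun n => ((continuous_absPhase l).comp (continuous_id.div_const _)).continuousOn)
    (hs.mul_left _) fun n y hy => ?_
  have hw : 0 ≤ y / x n := div_nonneg hy.1 (hx n).le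
  rw [Real.norm_eq_abs, abs_of_nonneg (absPhase_nonneg hl hw)]
  refine (absPhase_le hl hw).trans ?_
  rw [div_pow, div_eq_mul_inv]
  have := hy.1
  have := hy.2
  have := inv_nonneg.2 (pow_nonneg (hx n).le (l + 1))
  gcongr

/-- All contributions are nonnegative, and each of the first `N` zeros contributes at least `2/5`
once `y` is large. -/
theorem tendsto_totalPhase (hl : l = 0 ∨ l = 1) (hx : ∀ n, 0 < x n)
    (hs : Summable fun n => (x n ^ (l + 1))⁻¹) : Tendsto (totalPhase l x) atTop atTop := by
  refine tendsto_atTop.2 fun M => ?_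
  obtain ⟨N, hN⟩ := exists_nat_gt (M * (5 / 2))
  have hev : ∀ᶠ y in atTop, ∀ n ∈ Finset.range N, 2 * x n ≤ y :=
    (Finset.eventually_all _).2 fun n _ => eventually_ge_atTop _
  filter_upwards [hev, eventually_ge_atTop 0] with y hy hy0
  have h1 := (summable_absPhase hl hx hs hy0).sum_le_tsum (Finset.range N)
    fun n _ => absPhase_nonneg hl (div_nonneg hy0 (hx n).le)
  have h2 : ∑ n ∈ Finset.range N, (2 / 5 : ℝ) ≤ ∑ n ∈ Finset.range N, absPhase l (y / x n) :=
    Finset.sum_le_sum fun n hn => le_absPhase hl (by rw [le_div_iff₀ (hx n)]; exact hy n hn)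
  simp at h2
  refine le_trans ?_ (h2.trans h1)
  linarith

theorem canonicalProduct_I_mul (hl : l = 0 ∨ l = 1) (hδ : 0 < δ) (hx : ∀ n, δ ≤ x n)
    (hs : Summable fun n => (x n ^ (l + 1))⁻¹) {y : ℝ} (hy : 0 ≤ y) :
    canonicalProduct l x (Complex.I * y) = ‖canonicalProduct l x (Complex.I * y)‖ *
      Complex.exp ((((-1) ^ (l + 1) * totalPhase l x y : ℝ) : ℂ) * Complex.I) := by
  have hx0 : ∀ n, 0 < x n := fun n => hδ.trans_le (hx n)
  have h := hasProd_canonicalProduct hl hδ hx hs (Complex.I * y)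
  have hn : HasProd (fun n => ((‖zeroFactor l (x n) (Complex.I * y)‖ : ℝ) : ℂ))
      ((‖canonicalProduct l x (Complex.I * y)‖ : ℝ) : ℂ) :=
    h.norm.map Complex.ofRealHom Complex.continuous_ofReal
  have hp : HasSum (fun n => (((-1) ^ (l + 1) * absPhase l (y / x n) : ℝ) : ℂ) * Complex.I)
      ((((-1) ^ (l + 1) * totalPhase l x y : ℝ) : ℂ) * Complex.I) :=
    (Complex.hasSum_ofReal.2 ((summable_absPhase hl hx0 hs hy).hasSum.mul_left _)).mul_right _
  refine h.unique ((hn.mul hp.cexp).congr_fun fun n => ?_)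
  have hsq : (-1 : ℝ) ^ (l + 1) * absPhase l (y / x n) = l * (y / x n) - Real.arctan (y / x n) := by
    rw [absPhase, ← mul_assoc, ← pow_add, Even.neg_one_pow ⟨l + 1, rfl⟩, one_mul]
  have hpos : (0 : ℝ) ≤ √(1 + (y / x n) ^ 2) := by positivity
  simp only [Function.comp_apply]
  rw [hsq, zeroFactor_I_mul, norm_mul, Complex.norm_exp_ofReal_mul_I, mul_one, Complex.norm_real,
    Real.norm_of_nonneg hpos]

theorem exists_totalPhase_eq (hl : l = 0 ∨ l = 1) (hx : ∀ n, 0 < x n)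
    (hs : Summable fun n => (x n ^ (l + 1))⁻¹) {Y v : ℝ} (hY : 0 ≤ Y)
    (hv : totalPhase l x Y ≤ v) : ∃ y ≥ Y, totalPhase l x y = v := by
  obtain ⟨R, hR1, hR2⟩ := (((tendsto_totalPhase hl hx hs).eventually_ge_atTop v).and
    (eventually_ge_atTop Y)).exists
  obtain ⟨y, hy, rfl⟩ := intermediate_value_Icc hR2
    ((continuousOn_totalPhase hl hx hs R).mono (Set.Icc_subset_Icc_left hY)) ⟨hv, hR1⟩
  exact ⟨y, hy.1, rfl⟩

/-- On the imaginary axis, the real part of a canonical product with positive zeros takes both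
signs arbitrarily far out. -/
theorem exists_re_canonicalProduct (hl : l = 0 ∨ l = 1) (hδ : 0 < δ) (hx : ∀ n, δ ≤ x n)
    (hs : Summable fun n => (x n ^ (l + 1))⁻¹) (Y : ℝ) :
    (∃ y : ℝ, Y ≤ y ∧ 0 ≤ (canonicalProduct l x (Complex.I * y)).re) ∧
      ∃ y : ℝ, Y ≤ y ∧ (canonicalProduct l x (Complex.I * y)).re ≤ 0 := by
  have hx0 : ∀ n, 0 < x n := fun n => hδ.trans_le (hx n)
  obtain ⟨k, hk⟩ := exists_nat_ge (totalPhase l x (max Y 0))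
  have hpi := Real.pi_gt_three
  have hk0 : (0 : ℝ) ≤ k := k.cast_nonneg
  have hre : ∀ y : ℝ, 0 ≤ y → (canonicalProduct l x (Complex.I * y)).re =
      ‖canonicalProduct l x (Complex.I * y)‖ * Real.cos (totalPhase l x y) := by
    intro y hy
    have h := congrArg Complex.re (canonicalProduct_I_mul hl hδ hx hs hy)
    rw [Complex.re_ofReal_mul, Complex.exp_ofReal_mul_I_re] at h
    rw [h]
    -- The sign `(-1) ^ (l + 1)` of the argument disappears because cosine is even.
    rcases hl with rfl | rfl <;> simp
  constructor
  · obtain ⟨y, hy, hy'⟩ := exists_totalPhase_eq hl hx0 hs (le_max_right Y 0)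
      (v := k * (2 * Real.pi)) (hk.trans (by nlinarith))
    refine ⟨y, (le_max_left _ _).trans hy, ?_⟩
    rw [hre y ((le_max_right _ _).trans hy), hy', Real.cos_nat_mul_two_pi, mul_one]
    exact norm_nonneg _
  · obtain ⟨y, hy, hy'⟩ := exists_totalPhase_eq hl hx0 hs (le_max_right Y 0)
      (v := k * (2 * Real.pi) + Real.pi) (hk.trans (by nlinarith))
    refine ⟨y, (le_max_left _ _).trans hy, ?_⟩
    rw [hre y ((le_max_right _ _).trans hy), hy', Real.cos_nat_mul_two_pi_add_pi, mul_neg_one]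
    exact neg_nonpos.2 (norm_nonneg _)

end Phase

/-! ### From alternating even coefficients to a constant sign on the imaginary axis -/

section Signs

theorem HasMaclaurinCoeffs.hasSum_re_I_mul {f : ℂ → ℂ} {a : ℕ → ℝ} (ha : HasMaclaurinCoeffs f a)
    (y : ℝ) : HasSum (fun k : ℕ => (-1) ^ k * a (2 * k) * y ^ (2 * k)) (f (Complex.I * y)).re := by
  have h := Complex.hasSum_re (ha (Complex.I * y))
  have hinj : Function.Injective fun n : ℕ => 2 * n := fun m n h => by simpa using h
  refine ((hinj.hasSum_iff fun n hn => ?_).2 h).congr_fun fun k => ?_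
  · obtain ⟨m, rfl⟩ : Odd n := by
      rw [← Nat.not_even_iff_odd, even_iff_two_dvd]
      exact fun ⟨m, hm⟩ => hn ⟨m, hm.symm⟩
    have : (a (2 * m + 1) : ℂ) * (Complex.I * y) ^ (2 * m + 1) =
        ((a (2 * m + 1) * (-1) ^ m * y ^ (2 * m + 1) : ℝ) : ℂ) * Complex.I := by
      rw [mul_pow, pow_succ Complex.I, pow_mul, Complex.I_sq]; push_cast; ring
    rw [this, Complex.re_ofReal_mul, Complex.I_re, mul_zero]
  · have : (a (2 * k) : ℂ) * (Complex.I * y) ^ (2 * k) =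
        (((-1) ^ k * a (2 * k) * y ^ (2 * k) : ℝ) : ℂ) := by
      rw [mul_pow, pow_mul, Complex.I_sq]; push_cast; ring
    simp only [Function.comp_apply]
    rw [this, Complex.ofReal_re]

/-- Terms beyond index `K` only help, and the `K`-th term outgrows the finitely many earlier ones.
-/
theorem HasMaclaurinCoeffs.re_pos_of_coeff_pos {f : ℂ → ℂ} {a : ℕ → ℝ}
    (ha : HasMaclaurinCoeffs f a) {K : ℕ} (hK : ∀ k ≥ K, 0 < (-1) ^ k * a (2 * k)) :
    ∃ Y : ℝ, ∀ y : ℝ, Y ≤ y → 0 < (f (Complex.I * y)).re := by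
  set p : ℕ → ℝ := fun k => (-1) ^ k * a (2 * k) with hp
  have hpK : 0 < p K := hK K le_rfl
  set S : ℝ := ∑ k ∈ Finset.range K, |p k| with hS
  have hS0 : 0 ≤ S := Finset.sum_nonneg fun k _ => abs_nonneg _
  refine ⟨S / p K + 1, fun y hy => ?_⟩
  have hy1 : 1 ≤ y := le_trans (by have := div_nonneg hS0 hpK.le; linarith) hy
  have h := ha.hasSum_re_I_mul y
  have h1 : ∑ k ∈ Finset.range (K + 1), p k * y ^ (2 * k) ≤ (f (Complex.I * y)).re :=
    sum_le_hasSum _ (fun k hk => by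
      have : K ≤ k := by simp at hk; omega
      have := hK k this
      positivity) h
  rw [Finset.sum_range_succ] at h1
  have h2 : -(S * y ^ (2 * K - 1)) ≤ ∑ k ∈ Finset.range K, p k * y ^ (2 * k) := by
    rw [hS, Finset.sum_mul, ← Finset.sum_neg_distrib]
    refine Finset.sum_le_sum fun k hk => ?_
    have hk' : 2 * k ≤ 2 * K - 1 := by simp at hk; omega
    have h3 : y ^ (2 * k) ≤ y ^ (2 * K - 1) := pow_le_pow_right₀ hy1 hk'
    have h4 : 0 ≤ y ^ (2 * k) := by positivity
    nlinarith [neg_abs_le (p k), abs_nonneg (p k), mul_le_mul_of_nonneg_left h3 (abs_nonneg (p k))]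
  have h5 : S < p K * y := by
    have : S / p K < y := by linarith
    rw [div_lt_iff₀ hpK] at this
    linarith
  -- For `K = 0` the exponent `2 * K - 1` is truncated to 0, but then there are no earlier terms.
  rcases Nat.eq_zero_or_pos K with rfl | hK0
  · simp at h1
    linarith
  · have h6 : y ^ (2 * K) = y ^ (2 * K - 1) * y := by
      rw [← pow_succ]; congr 1; omega
    have h7 : 0 < y ^ (2 * K - 1) := by positivity
    rw [h6] at h1
    nlinarith

/-- Only odd `n` are used: strict alternation of the even coefficients would give the real part on
the imaginary axis a strict eventual sign. -/
theorem HasMaclaurinCoeffs.exists_coeff_mul_pos {f : ℂ → ℂ} {a : ℕ → ℝ}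
    (ha : HasMaclaurinCoeffs f a)
    (hzero : ∀ k m, 2 ≤ k → 2 ≤ m → k ≠ m → ¬ (a (2 * k) = 0 ∧ a (2 * m) = 0))
    (hpos : ∀ Y : ℝ, ∃ y : ℝ, Y ≤ y ∧ 0 ≤ (f (Complex.I * y)).re)
    (hneg : ∀ Y : ℝ, ∃ y : ℝ, Y ≤ y ∧ (f (Complex.I * y)).re ≤ 0) (n₀ : ℕ) :
    ∃ n > n₀, 0 < a (n - 1) * a (n + 1) := by
  by_contra! h
  obtain ⟨K, hKn, hK⟩ : ∃ K, n₀ ≤ K ∧ ∀ k ≥ K, a (2 * k) ≠ 0 := by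
    by_cases hex : ∃ k, 2 ≤ k ∧ a (2 * k) = 0
    · obtain ⟨k, hk, hk0⟩ := hex
      exact ⟨n₀ + k + 1, by omega, fun m hm hm0 =>
        hzero k m hk (by omega) (by omega) ⟨hk0, hm0⟩⟩
    · push Not at hex
      exact ⟨n₀ + 2, by omega, fun k hk => hex k (by omega)⟩
  -- The assumed inequality at `n = 2k + 1` is strict since both coefficients are nonzero.
  have hstep : ∀ k ≥ K, 0 < ((-1) ^ k * a (2 * k)) * ((-1) ^ (k + 1) * a (2 * (k + 1))) := by
    intro k hk
    have h1 := h (2 * k + 1) (by omega)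
    rw [show 2 * k + 1 - 1 = 2 * k by omega, show 2 * k + 1 + 1 = 2 * (k + 1) by ring] at h1
    have h2 : a (2 * k) * a (2 * (k + 1)) < 0 :=
      lt_of_le_of_ne h1 (mul_ne_zero (hK k hk) (hK (k + 1) (by omega)))
    have h3 : ((-1 : ℝ) ^ k) * (-1) ^ k = 1 := by
      rw [← pow_add, Even.neg_one_pow ⟨k, rfl⟩]
    have : ((-1) ^ k * a (2 * k)) * ((-1) ^ (k + 1) * a (2 * (k + 1))) =
        -(a (2 * k) * a (2 * (k + 1))) := by
      rw [pow_succ]; linear_combination (-(a (2 * k) * a (2 * (k + 1)))) * h3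
    linarith
  rcases lt_or_gt_of_ne (show (-1) ^ K * a (2 * K) ≠ 0 from
    mul_ne_zero (by simp) (hK K le_rfl)) with hs | hs
  · have ha' : HasMaclaurinCoeffs (fun z => -f z) fun n => -a n := fun z => by
      simpa using (ha z).neg
    obtain ⟨Y, hY⟩ := ha'.re_pos_of_coeff_pos (K := K) fun k hk => by
      have : (-1) ^ k * a (2 * k) < 0 := by
        induction k, hk using Nat.le_induction with
        | base => exact hs
        | succ k hk ih =>
            rcases mul_pos_iff.1 (hstep k hk) with h' | h'
            · linarith [h'.1]
            · exact h'.2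
      linarith
    obtain ⟨y, hy, hy'⟩ := hpos Y
    have := hY y hy
    simp at this
    linarith
  · obtain ⟨Y, hY⟩ := ha.re_pos_of_coeff_pos (K := K) fun k hk => by
      induction k, hk using Nat.le_induction with
      | base => exact hs
      | succ k hk ih =>
        rcases mul_pos_iff.1 (hstep k hk) with h' | h'
        · exact h'.2
        · linarith [h'.1]
    obtain ⟨y, hy, hy'⟩ := hneg Y
    linarith [hY y hy]

end Signs

/-! ### Growth estimates and the order -/

section Order

/-- Subadditivity gives `(1 + w)^s ≤ 1 + w^s ≤ exp (w^s)`; then take `s`-th roots. -/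
theorem one_add_le_exp_rpow {s w : ℝ} (hs : 0 < s) (hs1 : s ≤ 1) (hw : 0 ≤ w) :
    1 + w ≤ Real.exp (w ^ s / s) := by
  have h1 : (1 + w) ^ s ≤ 1 + w ^ s := by
    simpa using Real.rpow_add_le_add_rpow zero_le_one hw hs.le hs1
  have h2 : (1 + w) ^ s ≤ Real.exp (w ^ s) := h1.trans (by
    rw [add_comm]; exact Real.add_one_le_exp _)
  have h3 : 0 ≤ 1 + w := by linarith
  calc 1 + w = ((1 + w) ^ s) ^ s⁻¹ := by rw [← Real.rpow_mul h3, mul_inv_cancel₀ hs.ne', Real.rpow_one]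
    _ ≤ Real.exp (w ^ s) ^ s⁻¹ := by gcongr
    _ = Real.exp (w ^ s / s) := by rw [← Real.exp_mul, div_eq_mul_inv]

theorem norm_one_sub_mul_exp_le_sq (w : ℂ) :
    ‖(1 - w) * Complex.exp w‖ ≤ Real.exp (‖w‖ ^ 2) := by
  have h1 : ‖1 - w‖ ^ 2 ≤ Real.exp (-2 * w.re + ‖w‖ ^ 2) := by
    have e : ‖1 - w‖ ^ 2 = -2 * w.re + ‖w‖ ^ 2 + 1 := by
      rw [← Complex.normSq_eq_norm_sq, ← Complex.normSq_eq_norm_sq]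
      simp [Complex.normSq_apply]; ring
    rw [e]; exact Real.add_one_le_exp _
  refine (sq_le_sq₀ (norm_nonneg _) (Real.exp_pos _).le).1 ?_
  rw [norm_mul, Complex.norm_exp, mul_pow, ← Real.exp_nat_mul, ← Real.exp_nat_mul]
  calc _ ≤ Real.exp (-2 * w.re + ‖w‖ ^ 2) * Real.exp ((2 : ℕ) * w.re) := by gcongr
    _ = Real.exp (‖w‖ ^ 2) := by rw [← Real.exp_add]; congr 1; push_cast; ring
    _ ≤ _ := by
      apply Real.exp_le_exp.2
      push_cast
      nlinarith [sq_nonneg ‖w‖]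

theorem norm_one_sub_mul_exp_le (w : ℂ) : ‖(1 - w) * Complex.exp w‖ ≤ Real.exp (2 * ‖w‖) := by
  rw [norm_mul, Complex.norm_exp, two_mul, Real.exp_add]
  have h1 : ‖1 - w‖ ≤ Real.exp ‖w‖ := by
    refine (norm_sub_le _ _).trans ?_
    rw [norm_one, add_comm]
    exact Real.add_one_le_exp _
  have h2 := Complex.re_le_norm w
  gcongr

theorem norm_zeroFactor_le {l : ℕ} (hl : l = 0 ∨ l = 1) {s t : ℝ} (hs : 0 < s) (hls : (l : ℝ) ≤ s)
    (hsl : s ≤ l + 1) (ht : 0 < t) (z : ℂ) :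
    ‖zeroFactor l t z‖ ≤ Real.exp ((1 / s + 2) * (‖z‖ / t) ^ s) := by
  have hw : ‖z / (t : ℂ)‖ = ‖z‖ / t := by simp [abs_of_pos ht]
  have hw0 : 0 ≤ ‖z‖ / t := by positivity
  have hws : 0 ≤ (‖z‖ / t) ^ s := Real.rpow_nonneg hw0 s
  rcases hl with rfl | rfl
  · have h1 : ‖zeroFactor 0 t z‖ ≤ 1 + ‖z‖ / t := by
      rw [← hw]
      simpa [zeroFactor] using norm_sub_le (1 : ℂ) (z / t)
    refine (h1.trans (one_add_le_exp_rpow hs (by simpa using hsl) hw0)).trans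
      (Real.exp_le_exp.2 ?_)
    rw [add_mul, one_div_mul_eq_div]
    linarith
  · have e : zeroFactor 1 t z = (1 - z / t) * Complex.exp (z / t) := by simp [zeroFactor]
    push_cast at hls hsl
    have hs' : 0 < 1 / s := by positivity
    rw [e]
    -- For `1 ≤ s ≤ 2`, the quadratic bound is below the `s`-th power when `‖z‖ ≤ t`, and the linear
    -- bound is below it when `‖z‖ ≥ t`.
    rcases le_total (‖z‖ / t) 1 with h | h
    · refine (norm_one_sub_mul_exp_le_sq _).trans (Real.exp_le_exp.2 ?_)
      rw [hw]
      have : (‖z‖ / t) ^ (2 : ℕ) ≤ (‖z‖ / t) ^ s := by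
        rw [← Real.rpow_natCast]
        rcases hw0.eq_or_lt with h0 | h0
        · rw [← h0, Real.zero_rpow hs.ne']; simp
        · exact Real.rpow_le_rpow_of_exponent_ge h0 h (by push_cast; linarith)
      nlinarith
    · refine (norm_one_sub_mul_exp_le _).trans (Real.exp_le_exp.2 ?_)
      rw [hw]
      have : ‖z‖ / t ≤ (‖z‖ / t) ^ s := by
        simpa using Real.rpow_le_rpow_of_exponent_le h hls
      nlinarith

variable {l : ℕ} {x : ℕ → ℝ} {δ : ℝ}

theorem exists_norm_canonicalProduct_le (hl : l = 0 ∨ l = 1) (hδ : 0 < δ) (hx : ∀ n, δ ≤ x n)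
    (hsum : Summable fun n => (x n ^ (l + 1))⁻¹) {s : ℝ} (hs : 0 < s) (hls : (l : ℝ) ≤ s)
    (hsl : s ≤ l + 1) (hss : Summable fun n => x n ^ (-s)) :
    ∃ C > 0, ∀ z, ‖canonicalProduct l x z‖ ≤ Real.exp (C * ‖z‖ ^ s) := by
  have hx0 : ∀ n, 0 < x n := fun n => hδ.trans_le (hx n)
  have hpos : ∀ n, 0 ≤ x n ^ (-s) := fun n => Real.rpow_nonneg (hx0 n).le _
  refine ⟨(1 / s + 2) * (∑' n, x n ^ (-s) + 1), by
    have := tsum_nonneg (L := .unconditional ℕ) hpos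
    positivity, fun z => ?_⟩
  refine le_of_tendsto (hasProd_canonicalProduct hl hδ hx hsum z).norm.tendsto_prod_nat
    (Eventually.of_forall fun N => ?_)
  calc ∏ n ∈ Finset.range N, ‖zeroFactor l (x n) z‖
      ≤ ∏ n ∈ Finset.range N, Real.exp ((1 / s + 2) * (‖z‖ / x n) ^ s) :=
        Finset.prod_le_prod (fun _ _ => norm_nonneg _)
          fun n _ => norm_zeroFactor_le hl hs hls hsl (hx0 n) z
    _ = Real.exp ((1 / s + 2) * ‖z‖ ^ s * ∑ n ∈ Finset.range N, x n ^ (-s)) := by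
        rw [← Real.exp_sum, Finset.mul_sum]
        congr 1
        refine Finset.sum_congr rfl fun n _ => ?_
        rw [Real.div_rpow (norm_nonneg z) (hx0 n).le, Real.rpow_neg (hx0 n).le]
        ring
    _ ≤ _ := by
        apply Real.exp_le_exp.2
        have h1 := hss.sum_le_tsum (Finset.range N) fun n _ => hpos n
        have h2 : 0 ≤ ‖z‖ ^ s := Real.rpow_nonneg (norm_nonneg _) _
        have h3 : 0 ≤ (1 / s + 2) * ‖z‖ ^ s := by positivity
        calc _ ≤ (1 / s + 2) * ‖z‖ ^ s * (∑' n, x n ^ (-s) + 1) :=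
              mul_le_mul_of_nonneg_left (by linarith) h3
          _ = _ := by ring

theorem maxModulus_le {f : ℂ → ℂ} {r B : ℝ} (hr : 0 ≤ r) (h : ∀ z, ‖z‖ = r → ‖f z‖ ≤ B) :
    maxModulus f r ≤ B := by
  refine csSup_le ((NormedSpace.sphere_nonempty.2 hr).image _) ?_
  rintro _ ⟨z, hz, rfl⟩
  exact h z (by simpa using hz)

theorem norm_le_maxModulus {f : ℂ → ℂ} (hf : Continuous f) (z : ℂ) :
    ‖f z‖ ≤ maxModulus f ‖z‖ :=
  le_csSup ((isCompact_sphere (0 : ℂ) ‖z‖).image hf.norm).bddAbove ⟨z, by simp, rfl⟩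

/-- At `z = i r` every factor has modulus `√(1 + (r / x k)²) ≥ 1`, and at least `√2` when `x k ≤ r`.
-/
theorem sqrt_two_pow_le_maxModulus (hl : l = 0 ∨ l = 1) (hδ : 0 < δ) (hx : ∀ n, δ ≤ x n)
    (hs : Summable fun n => (x n ^ (l + 1))⁻¹) (hmono : Monotone x) {n : ℕ} {r : ℝ}
    (hr : x n ≤ r) : √2 ^ (n + 1) ≤ maxModulus (canonicalProduct l x) r := by
  have hx0 : ∀ n, 0 < x n := fun n => hδ.trans_le (hx n)
  have hr0 : 0 < r := (hx0 n).trans_le hr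
  have h := norm_le_maxModulus (differentiable_canonicalProduct hl hδ hx hs).continuous
    (Complex.I * r)
  rw [norm_mul, Complex.norm_I, one_mul, Complex.norm_real, Real.norm_of_nonneg hr0.le] at h
  refine le_trans ?_ h
  have hnorm : ∀ k, ‖zeroFactor l (x k) (Complex.I * r)‖ = √(1 + (r / x k) ^ 2) := fun k => by
    have hpos : (0 : ℝ) ≤ √(1 + (r / x k) ^ 2) := by positivity
    rw [zeroFactor_I_mul, norm_mul, Complex.norm_exp_ofReal_mul_I, mul_one, Complex.norm_real,
      Real.norm_of_nonneg hpos]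
  refine ge_of_tendsto (hasProd_canonicalProduct hl hδ hx hs (Complex.I * r)).norm.tendsto_prod_nat ?_
  filter_upwards [eventually_ge_atTop (n + 1)] with N hN
  have h1 : √2 ^ (n + 1) ≤ ∏ k ∈ Finset.range (n + 1), ‖zeroFactor l (x k) (Complex.I * r)‖ := by
    have := Finset.prod_le_prod (s := Finset.range (n + 1)) (f := fun _ => √2)
      (g := fun k => ‖zeroFactor l (x k) (Complex.I * r)‖) (fun _ _ => Real.sqrt_nonneg _)
      fun k hk => by
        rw [hnorm]
        apply Real.sqrt_le_sqrt
        have : 1 ≤ r / x k := by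
          rw [le_div_iff₀ (hx0 k), one_mul]
          exact (hmono (by simpa [Nat.lt_succ_iff] using hk)).trans hr
        nlinarith
    simpa using this
  refine h1.trans ?_
  rw [← Finset.prod_range_mul_prod_Ico _ hN]
  refine le_mul_of_one_le_right (Finset.prod_nonneg fun _ _ => norm_nonneg _) ?_
  refine Finset.one_le_prod fun k _ => ?_
  rw [hnorm, Real.one_le_sqrt]
  nlinarith [sq_nonneg (r / x k)]

/-- The order of a canonical product with positive zeros, in terms of its zeros. -/
theorem entireOrder_canonicalProduct (hl : l = 0 ∨ l = 1) (hδ : 0 < δ) (hx : ∀ n, δ ≤ x n)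
    (hs : Summable fun n => (x n ^ (l + 1))⁻¹) (hmono : Monotone x) {ρ : ℝ}
    (hup : ∀ ε > 0, ∃ s : ℝ, 0 < s ∧ (l : ℝ) ≤ s ∧ s ≤ l + 1 ∧ s < ρ + ε ∧
      Summable fun n => x n ^ (-s))
    (hlow : ∀ s < ρ, ∃ᶠ n : ℕ in atTop, x n ^ s ≤ n + 1) :
    entireOrder (canonicalProduct l x) = (ρ : EReal) := by
  have hx0 : ∀ n, 0 < x n := fun n => hδ.trans_le (hx n)
  set M := maxModulus (canonicalProduct l x) with hM
  have hlog2 : 0 < Real.log √2 := Real.log_pos (by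
    rw [Real.lt_sqrt zero_le_one]; norm_num)
  have hlogM : ∀ n r, x n ≤ r → (n + 1) * Real.log √2 ≤ Real.log (M r) := fun n r hr => by
    have h := Real.log_le_log (by positivity) (sqrt_two_pow_le_maxModulus hl hδ hx hs hmono hr)
    rw [Real.log_pow] at h
    exact_mod_cast h
  apply le_antisymm
  · refine EReal.le_of_forall_lt_iff_le.1 fun c hc => ?_
    have hc' : ρ < c := by exact_mod_cast hc
    obtain ⟨s, hs0, hls, hsl, hsρ, hss⟩ := hup (c - ρ) (by linarith)
    obtain ⟨C, hC, hbound⟩ := exists_norm_canonicalProduct_le hl hδ hx hs hs0 hls hsl hss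
    refine limsup_le_of_le (by isBoundedDefault) ?_
    -- The threshold makes `log C + s log r ≤ c log r`.
    have hlogr : ∀ᶠ r : ℝ in atTop, Real.log C / (c - s) ≤ Real.log r :=
      Real.tendsto_log_atTop.eventually_ge_atTop _
    filter_upwards [hlogr, eventually_ge_atTop (x 0), eventually_gt_atTop 1] with r h1 h2 h3
    have hr0 : 0 < r := by linarith
    have hlr : 0 < Real.log r := Real.log_pos h3
    have h4 : M r ≤ Real.exp (C * r ^ s) := maxModulus_le hr0.le fun z hz => by
      rw [← hz]; exact hbound z
    have h5 := hlogM 0 r h2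
    have h6 : 0 < Real.log (M r) := lt_of_lt_of_le (by positivity) h5
    have hMpos : 0 < M r := lt_of_lt_of_le (by positivity)
      (sqrt_two_pow_le_maxModulus hl hδ hx hs hmono h2)
    have h7 : Real.log (M r) ≤ C * r ^ s := by
      simpa using Real.log_le_log hMpos h4
    have h8 : Real.log (Real.log (M r)) ≤ Real.log C + s * Real.log r := by
      have := Real.log_le_log h6 h7
      rwa [Real.log_mul hC.ne' (Real.rpow_pos_of_pos hr0 s).ne', Real.log_rpow hr0] at this
    rw [EReal.coe_le_coe_iff, div_le_iff₀ hlr]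
    rw [div_le_iff₀ (by linarith)] at h1
    linarith
  · refine EReal.ge_of_forall_gt_iff_ge.1 fun c hc => ?_
    have hc' : c < ρ := by exact_mod_cast hc
    refine le_limsup_of_frequently_le ?_ (by isBoundedDefault)
    have ht := tendsto_atTop_of_summable_inv_pow hx0 hs
    refine ht.frequently ?_
    -- At `r = x n`, replacing the exponent `(c + ρ)/2` by `c` leaves a margin that absorbs the
    -- constant `log log √2`.
    have hlogr : ∀ᶠ n in atTop, -Real.log (Real.log √2) / ((ρ - c) / 2) ≤ Real.log (x n) :=
      (Real.tendsto_log_atTop.comp ht).eventually_ge_atTop _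
    refine ((hlow ((c + ρ) / 2) (by linarith)).and_eventually
      (hlogr.and (ht.eventually_gt_atTop 1))).mono ?_
    rintro n ⟨h1, h2, h3⟩
    have hlr : 0 < Real.log (x n) := Real.log_pos h3
    have hn : (0 : ℝ) < n + 1 := by positivity
    have h4 := Real.log_le_log (Real.rpow_pos_of_pos (hx0 n) _) h1
    rw [Real.log_rpow (hx0 n)] at h4
    have h5 := Real.log_le_log (by positivity) (hlogM n (x n) le_rfl)
    rw [Real.log_mul hn.ne' hlog2.ne'] at h5
    rw [EReal.coe_le_coe_iff, le_div_iff₀ hlr]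
    rw [div_le_iff₀ (by linarith)] at h2
    linarith

end Order

/-! ### Zero sequences for every order in `[0, 2]` -/

section Zeros

/-- A nondecreasing sequence of numbers `≥ 2` such that the canonical product of genus `l` with
these zeros has order `ρ`. -/
structure IsZeroSequence (ρ : ℝ) (l : ℕ) (y : ℕ → ℝ) : Prop where
  genus : l = 0 ∨ l = 1
  two_le : ∀ n, 2 ≤ y n
  mono : Monotone y
  summable : Summable fun n => (y n ^ (l + 1))⁻¹
  not_summable : l = 1 → ¬ Summable fun n => (y n)⁻¹
  upper : ∀ ε > 0, ∃ s : ℝ, 0 < s ∧ (l : ℝ) ≤ s ∧ s ≤ l + 1 ∧ s < ρ + ε ∧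
    Summable fun n => y n ^ (-s)
  lower : ∀ s < ρ, ∃ᶠ n : ℕ in atTop, y n ^ s ≤ n + 1

theorem isZeroSequence_zero : IsZeroSequence 0 0 fun n => 2 ^ (n + 1) := by
  have key : ∀ s : ℝ, 0 < s → Summable fun n : ℕ => ((2 : ℝ) ^ (n + 1)) ^ (-s) := by
    intro s hs
    have h : Summable fun n : ℕ => ((2 : ℝ) ^ (-s)) ^ (n + 1) :=
      (summable_nat_add_iff 1).2 (summable_geometric_of_lt_one (by positivity)
        (Real.rpow_lt_one_of_one_lt_of_neg one_lt_two (by linarith)))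
    refine h.congr fun n => ?_
    rw [← Real.rpow_natCast, ← Real.rpow_natCast, ← Real.rpow_mul zero_le_two,
      ← Real.rpow_mul zero_le_two, mul_comm]
  have hone : ∀ n : ℕ, (1 : ℝ) ≤ 2 ^ (n + 1) := fun n => one_le_pow₀ one_le_two
  refine ⟨Or.inl rfl, fun n => ?_, fun m n hmn => ?_, ?_, by simp, fun ε hε => ?_, fun s hs => ?_⟩
  · have := one_le_pow₀ (one_le_two (α := ℝ)) (n := n)
    rw [pow_succ]; linarith
  · exact pow_le_pow_right₀ one_le_two (by omega)
  · simpa [Real.rpow_neg_one] using key 1 one_pos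
  · refine ⟨min (ε / 2) 1, by positivity, by simp; positivity, by simp, ?_, key _ (by positivity)⟩
    have := min_le_left (ε / 2) 1
    linarith
  · refine Eventually.frequently (Eventually.of_forall fun n => ?_)
    have := Real.rpow_le_one_of_one_le_of_nonpos (hone n) hs.le
    have : (0 : ℝ) ≤ n := n.cast_nonneg
    linarith

/-- The series of `(y n)^(-s)` converges exactly for `s > ρ`; in particular `ρ = 1` has genus 1. -/
theorem isZeroSequence_rpow {ρ : ℝ} {l : ℕ} (hl : l = 0 ∨ l = 1) (hρ : 0 < ρ) (hlρ : (l : ℝ) ≤ ρ)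
    (hρl : ρ < l + 1) : IsZeroSequence ρ l fun n => 2 * (n + 1 : ℝ) ^ (1 / ρ) := by
  have hpos : ∀ n : ℕ, (0 : ℝ) < n + 1 := fun n => by positivity
  have hrew : ∀ (n : ℕ) (s : ℝ), (2 * (n + 1 : ℝ) ^ (1 / ρ)) ^ s = 2 ^ s * (n + 1 : ℝ) ^ (s / ρ) := by
    intro n s
    rw [Real.mul_rpow zero_le_two (Real.rpow_nonneg (hpos n).le _), ← Real.rpow_mul (hpos n).le]
    congr 2
    ring
  have key : ∀ s : ℝ, (Summable fun n : ℕ => (2 * (n + 1 : ℝ) ^ (1 / ρ)) ^ (-s)) ↔ ρ < s := by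
    intro s
    simp only [hrew]
    rw [summable_mul_left_iff (Real.rpow_pos_of_pos two_pos _).ne']
    have h := summable_nat_add_iff (f := fun n : ℕ => (n : ℝ) ^ (-s / ρ)) 1
    push_cast at h
    rw [h, Real.summable_nat_rpow, neg_div, neg_lt_neg_iff, lt_div_iff₀ hρ, one_mul]
  have hinv : ∀ (n k : ℕ), ((2 * (n + 1 : ℝ) ^ (1 / ρ)) ^ k)⁻¹ =
      (2 * (n + 1 : ℝ) ^ (1 / ρ)) ^ (-(k : ℝ)) := fun n k => by
    rw [Real.rpow_neg (by positivity), Real.rpow_natCast]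
  refine ⟨hl, fun n => ?_, fun m n hmn => ?_, ?_, fun h => ?_, fun ε hε => ?_, fun s hs => ?_⟩
  · have : (1 : ℝ) ≤ (n + 1 : ℝ) ^ (1 / ρ) :=
      Real.one_le_rpow (by have : (0 : ℝ) ≤ n := n.cast_nonneg
                           linarith) (by positivity)
    linarith
  · have : (m : ℝ) ≤ n := by exact_mod_cast hmn
    gcongr
  · simp only [hinv]
    rw [key]
    push_cast
    exact hρl
  · subst h
    have h1 := (key 1).not.2 (not_lt.2 (by simpa using hlρ))
    simpa [Real.rpow_neg_one] using h1
  · have h1 : ρ < min (ρ + ε / 2) (l + 1) := lt_min (by linarith) hρl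
    refine ⟨min (ρ + ε / 2) (l + 1), hρ.trans h1, hlρ.trans h1.le, min_le_right _ _, ?_,
      (key _).2 h1⟩
    have := min_le_left (ρ + ε / 2) ((l : ℝ) + 1)
    linarith
  · have hexp : 0 < 1 - s / ρ := by rw [sub_pos, div_lt_one hρ]; exact hs
    have ht : Tendsto (fun n : ℕ => (n + 1 : ℝ) ^ (1 - s / ρ)) atTop atTop :=
      (tendsto_rpow_atTop hexp).comp (tendsto_atTop_add_const_right _ _ tendsto_natCast_atTop_atTop)
    refine ((ht.eventually_ge_atTop (2 ^ s)).mono fun n hn => ?_).frequently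
    rw [hrew]
    calc (2 : ℝ) ^ s * (n + 1 : ℝ) ^ (s / ρ)
        ≤ (n + 1 : ℝ) ^ (1 - s / ρ) * (n + 1 : ℝ) ^ (s / ρ) := by gcongr
      _ = n + 1 := by rw [← Real.rpow_add (hpos n)]; simp

/-- Order 2 with genus 1 requires `∑ (y n)⁻²` to converge, which `√n` alone just misses. The
logarithm restores convergence without changing the exponent. -/
theorem isZeroSequence_two :
    IsZeroSequence 2 1 fun n => 2 * √(n + 1 : ℝ) * (1 + Real.log (n + 1)) := by
  have hpos : ∀ n : ℕ, (0 : ℝ) < n + 1 := fun n => by positivity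
  have hlog : ∀ n : ℕ, 0 ≤ Real.log (n + 1) := fun n => Real.log_nonneg (by
    have : (0 : ℝ) ≤ n := n.cast_nonneg
    linarith)
  have hsq : ∀ n : ℕ, (1 : ℝ) ≤ √(n + 1) := fun n => by
    rw [Real.one_le_sqrt]
    have : (0 : ℝ) ≤ n := n.cast_nonneg
    linarith
  have hypos : ∀ n : ℕ, (0 : ℝ) < 2 * √(n + 1 : ℝ) * (1 + Real.log (n + 1)) := fun n => by
    have := hlog n
    have := hpos n
    positivity
  have hsum : Summable fun n : ℕ => ((2 * √(n + 1 : ℝ) * (1 + Real.log (n + 1))) ^ (1 + 1))⁻¹ := by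
    set f : ℕ → ℝ := fun n => ((2 * √(n : ℝ) * (1 + Real.log n)) ^ (1 + 1))⁻¹ with hf
    have h : Summable f := by
      -- Cauchy condensation reduces the series to one comparable with `∑ (k + 1)⁻²`.
      rw [← summable_condensed_iff_of_nonneg (fun n => by positivity) fun m n hm hmn => ?_]
      · have hb : Summable fun k : ℕ => (((k : ℝ) + 1) ^ 2)⁻¹ := by
          have := (summable_nat_add_iff 1).2 (Real.summable_nat_pow_inv.2 one_lt_two)
          simpa using this
        refine Summable.of_nonneg_of_le (fun k => by positivity) (fun k => ?_) hb
        simp only [hf]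
        have hl2 : (1 / 2 : ℝ) ≤ Real.log 2 := by have := Real.log_two_gt_d9; norm_num at this; linarith
        have hk : (0 : ℝ) ≤ k := k.cast_nonneg
        push_cast
        rw [Real.log_pow, mul_pow, mul_pow, Real.sq_sqrt (by positivity)]
        have h1 : ((k : ℝ) + 1) ≤ 2 * (1 + k * Real.log 2) := by nlinarith
        calc (2 : ℝ) ^ k * (2 ^ 2 * 2 ^ k * (1 + k * Real.log 2) ^ 2)⁻¹
            = ((2 * (1 + k * Real.log 2)) ^ 2)⁻¹ := by
              have : 0 < 1 + k * Real.log 2 := by positivity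
              field_simp
          _ ≤ (((k : ℝ) + 1) ^ 2)⁻¹ := by gcongr
      · have hm' : (1 : ℝ) ≤ m := by exact_mod_cast hm
        have hmn' : (m : ℝ) ≤ n := by exact_mod_cast hmn
        have := Real.log_nonneg hm'
        simp only [hf]
        gcongr
    simpa [hf] using (summable_nat_add_iff 1).2 h
  refine ⟨Or.inr rfl, fun n => ?_, fun m n hmn => ?_, hsum, fun _ h => ?_, fun ε hε => ?_,
    fun s hs => ?_⟩
  · nlinarith [hlog n, hsq n]
  · have : (m : ℝ) ≤ n := by exact_mod_cast hmn
    have := hpos m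
    have := hlog m
    gcongr
  · have hle : ∀ n : ℕ, (4 : ℝ)⁻¹ * ((n : ℝ) + 1)⁻¹ ≤ (2 * √(n + 1 : ℝ) * (1 + Real.log (n + 1)))⁻¹ := by
      intro n
      rw [← mul_inv]
      apply inv_anti₀ (hypos n)
      -- This gives `y n ≤ 4 (n + 1)`, so `∑ (y n)⁻¹` diverges with the harmonic series.
      have h1 : Real.log (n + 1) ≤ 2 * √(n + 1 : ℝ) - 2 := by
        have h2 := Real.log_le_sub_one_of_pos (lt_of_lt_of_le one_pos (hsq n))
        rw [Real.log_sqrt (hpos n).le] at h2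
        linarith
      have h3 := Real.mul_self_sqrt (hpos n).le
      nlinarith [hsq n]
    have h1 : Summable fun n : ℕ => (4 : ℝ)⁻¹ * ((n : ℝ) + 1)⁻¹ :=
      Summable.of_nonneg_of_le (fun n => by positivity) hle h
    rw [summable_mul_left_iff (by norm_num)] at h1
    have h2 := (summable_nat_add_iff (f := fun n : ℕ => (n : ℝ)⁻¹) 1).1 (by simpa using h1)
    exact Real.not_summable_natCast_inv h2
  · refine ⟨2, two_pos, by norm_num, by norm_num, by linarith, hsum.congr fun n => ?_⟩
    rw [Real.rpow_neg (hypos n).le]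
    norm_num
  · rcases le_or_gt s 0 with hs0 | hs0
    · refine Eventually.frequently (Eventually.of_forall fun n => ?_)
      have h1 : (1 : ℝ) ≤ 2 * √(n + 1 : ℝ) * (1 + Real.log (n + 1)) := by
        nlinarith [hlog n, hsq n]
      have := Real.rpow_le_one_of_one_le_of_nonpos h1 hs0
      have : (0 : ℝ) ≤ n := n.cast_nonneg
      linarith
    · have hr : 0 < 1 / s - 1 / 2 := by
        rw [sub_pos]; exact one_div_lt_one_div_of_lt hs0 hs
      have ht : Tendsto (fun n : ℕ => (n + 1 : ℝ)) atTop atTop :=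
        tendsto_atTop_add_const_right _ _ tendsto_natCast_atTop_atTop
      have h1 := ht.eventually ((isLittleO_log_rpow_atTop hr).bound (show (0 : ℝ) < 1 / 4 by norm_num))
      have h2 := ((tendsto_rpow_atTop hr).comp ht).eventually_ge_atTop 4
      refine ((h1.and h2).mono fun n hn => ?_).frequently
      obtain ⟨h3, h4⟩ := hn
      simp only [Function.comp_apply] at h4
      have hp := Real.rpow_pos_of_pos (hpos n) (1 / s - 1 / 2)
      rw [Real.norm_of_nonneg (hlog n), Real.norm_of_nonneg hp.le] at h3
      have h5 : 2 * √(n + 1 : ℝ) * (1 + Real.log (n + 1)) ≤ (n + 1 : ℝ) ^ (1 / s) := by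
        calc 2 * √(n + 1 : ℝ) * (1 + Real.log (n + 1))
            = √(n + 1 : ℝ) * (2 * (1 + Real.log (n + 1))) := by ring
          _ ≤ √(n + 1 : ℝ) * (n + 1 : ℝ) ^ (1 / s - 1 / 2) := by gcongr; linarith
          _ = (n + 1 : ℝ) ^ (1 / s) := by
            rw [Real.sqrt_eq_rpow, ← Real.rpow_add (hpos n)]; congr 1; ring
      calc _ ≤ ((n + 1 : ℝ) ^ (1 / s)) ^ s := Real.rpow_le_rpow (hypos n).le h5 hs0.le
        _ = n + 1 := by rw [← Real.rpow_mul (hpos n).le, one_div_mul_cancel hs0.ne', Real.rpow_one]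

theorem exists_isZeroSequence {ρ : ℝ} (h0 : 0 ≤ ρ) (h2 : ρ ≤ 2) : ∃ l y, IsZeroSequence ρ l y := by
  rcases h0.eq_or_lt with rfl | h0
  · exact ⟨_, _, isZeroSequence_zero⟩
  rcases h2.eq_or_lt with rfl | h2
  · exact ⟨_, _, isZeroSequence_two⟩
  rcases lt_or_ge ρ 1 with h1 | h1
  · exact ⟨0, _, isZeroSequence_rpow (Or.inl rfl) h0 (by simpa using h0.le) (by simpa using h1)⟩
  · exact ⟨1, _, isZeroSequence_rpow (Or.inr rfl) h0 (by simpa using h1) (by norm_num; exact h2)⟩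

/-- The sequence `p, q, r, y 0, y 1, …`. -/
def prependThree (p q r : ℝ) (y : ℕ → ℝ) : ℕ → ℝ
  | 0 => p
  | 1 => q
  | 2 => r
  | n + 3 => y n

theorem prependThree_forall {p q r : ℝ} {y : ℕ → ℝ} {P : ℝ → Prop} (hp : P p) (hq : P q)
    (hr : P r) (hy : ∀ n, P (y n)) : ∀ n, P (prependThree p q r y n)
  | 0 => hp
  | 1 => hq
  | 2 => hr
  | n + 3 => hy n

theorem monotone_prependThree {p q r : ℝ} {y : ℕ → ℝ} (hpq : p ≤ q) (hqr : q ≤ r) (hr : r ≤ y 0)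
    (hy : Monotone y) : Monotone (prependThree p q r y) :=
  monotone_nat_of_le_succ fun n => match n with
    | 0 => hpq
    | 1 => hqr
    | 2 => hr
    | n + 3 => hy n.le_succ

/-- Summability ignores finitely many terms, and the index shift by 3 only weakens the lower
counting condition. -/
theorem IsZeroSequence.entireOrder_prependThree {ρ : ℝ} {l : ℕ} {y : ℕ → ℝ}
    (h : IsZeroSequence ρ l y) {δ p q r : ℝ} (hδ : 0 < δ) (hδ2 : δ ≤ 2) (hp : δ ≤ p) (hpq : p ≤ q)
    (hqr : q ≤ r) (hr : r ≤ 2) :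
    entireOrder (canonicalProduct l (prependThree p q r y)) = (ρ : EReal) := by
  have hge : ∀ n, δ ≤ prependThree p q r y n := prependThree_forall hp (hp.trans hpq)
    (hp.trans (hpq.trans hqr)) fun n => hδ2.trans (h.two_le n)
  refine entireOrder_canonicalProduct h.genus hδ hge ((summable_nat_add_iff 3).1 h.summable)
    (monotone_prependThree hpq hqr (hr.trans (h.two_le 0)) h.mono) (fun ε hε => ?_) fun s hs => ?_
  · obtain ⟨s, hs0, hls, hsl, hsρ, hss⟩ := h.upper ε hε
    exact ⟨s, hs0, hls, hsl, hsρ, (summable_nat_add_iff 3).1 hss⟩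
  · refine (tendsto_add_atTop_nat 3).frequently ((h.lower s hs).mono fun n hn => ?_)
    refine le_trans (show prependThree p q r y (n + 3) ^ s ≤ n + 1 from hn) ?_
    push_cast
    linarith

end Zeros

/-! ### The construction and the final theorem -/

section Main

/-- Cubics near `(X - 1)(X - 2)(X - 3)` with the same sum of zeros have three real zeros. -/
theorem exists_cubic_roots {e₂ e₃ : ℝ} (h₂ : e₂ ∈ Set.Ioo (11 - 1 / 20 : ℝ) (11 + 1 / 20))
    (h₃ : e₃ ∈ Set.Ioo (6 - 1 / 20 : ℝ) (6 + 1 / 20)) :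
    ∃ r₁ r₂ r₃ : ℝ, 1 / 2 ≤ r₁ ∧ r₁ ≤ r₂ ∧ r₂ ≤ r₃ ∧ r₃ ≤ 4 ∧ r₁ + r₂ + r₃ = 6 ∧
      r₁ * r₂ + r₁ * r₃ + r₂ * r₃ = e₂ ∧ r₁ * r₂ * r₃ = e₃ := by
  obtain ⟨h₂l, h₂u⟩ := h₂
  obtain ⟨h₃l, h₃u⟩ := h₃
  set f : ℝ → ℝ := fun r => r ^ 3 - 6 * r ^ 2 + e₂ * r - e₃ with hf
  have hc : Continuous f := by fun_prop
  -- The tolerance `1/20` is small enough to keep the signs of the unperturbed cubic at `1/2`,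
  -- `3/2`, `5/2` and `4`.
  obtain ⟨r₁, hr₁, hf₁⟩ : (0 : ℝ) ∈ f '' Set.Ioo (1 / 2) (3 / 2) :=
    intermediate_value_Ioo (by norm_num) hc.continuousOn
      ⟨by simp only [hf]; linarith, by simp only [hf]; linarith⟩
  obtain ⟨r₂, hr₂, hf₂⟩ : (0 : ℝ) ∈ f '' Set.Ioo (3 / 2) (5 / 2) :=
    intermediate_value_Ioo' (by norm_num) hc.continuousOn
      ⟨by simp only [hf]; linarith, by simp only [hf]; linarith⟩
  obtain ⟨r₃, hr₃, hf₃⟩ : (0 : ℝ) ∈ f '' Set.Ioo (5 / 2) 4 :=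
    intermediate_value_Ioo (by norm_num) hc.continuousOn
      ⟨by simp only [hf]; linarith, by simp only [hf]; linarith⟩
  simp only [hf] at hf₁ hf₂ hf₃
  obtain ⟨hr₁l, hr₁u⟩ := hr₁
  obtain ⟨hr₂l, hr₂u⟩ := hr₂
  obtain ⟨hr₃l, hr₃u⟩ := hr₃
  -- Vieta's formulas are recovered from divided differences of `f` at the distinct roots.
  have q₁ : r₁ ^ 2 + r₁ * r₂ + r₂ ^ 2 - 6 * (r₁ + r₂) + e₂ = 0 :=
    mul_left_cancel₀ (sub_ne_zero.2 (show r₁ < r₂ by linarith).ne') (by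
      linear_combination hf₂ - hf₁)
  have q₂ : r₂ ^ 2 + r₂ * r₃ + r₃ ^ 2 - 6 * (r₂ + r₃) + e₂ = 0 :=
    mul_left_cancel₀ (sub_ne_zero.2 (show r₂ < r₃ by linarith).ne') (by
      linear_combination hf₃ - hf₂)
  have q₃ : r₁ + r₂ + r₃ = 6 := by
    have : r₁ + r₂ + r₃ - 6 = 0 :=
      mul_left_cancel₀ (sub_ne_zero.2 (show r₁ < r₃ by linarith).ne') (by
        linear_combination q₂ - q₁)
    linarith
  have q₄ : r₁ * r₂ + r₁ * r₃ + r₂ * r₃ = e₂ := by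
    linear_combination (r₁ + r₂) * q₃ - q₁
  refine ⟨r₁, r₂, r₃, hr₁l.le, by linarith, by linarith, hr₃u.le, q₃, q₄, ?_⟩
  linear_combination hf₁ - r₁ ^ 2 * q₃ + r₁ * q₄

/-- The exponential part depends only on the sum of the `rᵢ`; hence fixing the sum keeps it
independent of `e₂` and `e₃`. -/
theorem prod_zeroFactor_three (l : ℕ) (r₁ r₂ r₃ : ℝ) (z : ℂ) :
    zeroFactor l (1 / r₃) z * zeroFactor l (1 / r₂) z * zeroFactor l (1 / r₁) z =
      (1 - (r₁ + r₂ + r₃ : ℝ) * z + (r₁ * r₂ + r₁ * r₃ + r₂ * r₃ : ℝ) * z ^ 2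
        - (r₁ * r₂ * r₃ : ℝ) * z ^ 3) * Complex.exp ((((r₁ + r₂ + r₃) * l : ℝ) : ℂ) * z) := by
  have h : Complex.exp ((((r₁ + r₂ + r₃) * l : ℝ) : ℂ) * z) = Complex.exp (l * z / (1 / r₃ : ℝ)) *
      Complex.exp (l * z / (1 / r₂ : ℝ)) * Complex.exp (l * z / (1 / r₁ : ℝ)) := by
    rw [← Complex.exp_add, ← Complex.exp_add]
    congr 1
    push_cast
    simp only [one_div, div_inv_eq_mul]
    ring
  rw [h]
  simp only [zeroFactor]
  push_cast
  simp only [one_div, div_inv_eq_mul]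
  ring

theorem coeff_cubic_mul (F : PowerSeries ℝ) (s e₂ e₃ : ℝ) (n : ℕ) :
    PowerSeries.coeff (n + 3) (((1 - Polynomial.C s * Polynomial.X + Polynomial.C e₂ *
      Polynomial.X ^ 2 - Polynomial.C e₃ * Polynomial.X ^ 3 : Polynomial ℝ) : PowerSeries ℝ) * F) =
    PowerSeries.coeff (n + 3) F - s * PowerSeries.coeff (n + 2) F + e₂ * PowerSeries.coeff (n + 1) F
      - e₃ * PowerSeries.coeff n F := by
  push_cast
  rw [sub_mul, add_mul, sub_mul, one_mul, mul_assoc, mul_assoc, mul_assoc]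
  simp only [map_sub, map_add, PowerSeries.coeff_C_mul]
  rw [PowerSeries.coeff_X_pow_mul, show n + 3 = (n + 1) + 2 by ring, PowerSeries.coeff_X_pow_mul,
    show n + 1 + 2 = (n + 2) + 1 by ring, PowerSeries.coeff_succ_X_mul]

/-- For every `ρ ∈ [0, 2]` there is a canonical product of order `ρ` with positive zeros such that
the sign condition on the coefficients of its product with `exp (a z²)` fails for all `a < 0`. -/
theorem exists_canonicalProduct_sign_failure {ρ : ℝ} (h0 : 0 ≤ ρ) (h2 : ρ ≤ 2) :
    ∃ (l : ℕ) (x : ℕ → ℝ) (δ : ℝ), (l = 0 ∨ l = 1) ∧ 0 < δ ∧ (∀ n, δ ≤ x n) ∧ Monotone x ∧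
      (Summable fun n => (x n ^ (l + 1))⁻¹) ∧ (l = 1 → ¬ Summable fun n => (x n)⁻¹) ∧
      entireOrder (canonicalProduct l x) = (ρ : EReal) ∧
      ∀ a : ℝ, a < 0 → ∃ α : ℕ → ℝ,
        HasMaclaurinCoeffs (fun z : ℂ => Complex.exp (a * z ^ 2) * canonicalProduct l x z) α ∧
        ∀ n₀ : ℕ, ∃ n > n₀, 0 < α (n - 1) * α (n + 1) := by
  obtain ⟨l, y, hy⟩ := exists_isZeroSequence h0 h2
  obtain ⟨G, -, hG⟩ := exists_realRootedClosure_canonicalProduct hy.genus two_pos hy.two_le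
    hy.summable
  have hEm := (hasMaclaurinCoeffs_expLinear (6 * l)).mul hG
  have hE0 : PowerSeries.coeff 0 (expLinear (6 * l) * G) = 1 := by
    have := hEm.coeff_zero
    simp only [canonicalProduct_zero, mul_zero, Complex.exp_zero, mul_one] at this
    exact_mod_cast this
  obtain ⟨e₂, he₂, e₃, he₃, hgen⟩ := exists_generic_parameters hE0
    (fun a ha n => by
      rw [eval_expSqCoeff, eval_expSqCoeff]
      exact not_consecutive_coeff_eq_zero hy.genus two_pos hy.two_le hy.summable hG _ ha n)
    6 (show (11 - 1 / 20 : ℝ) < 11 + 1 / 20 by norm_num)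
    (show (6 - 1 / 20 : ℝ) < 6 + 1 / 20 by norm_num)
  obtain ⟨r₁, r₂, r₃, hr₁, hr₁₂, hr₂₃, hr₃, hs₁, hs₂, hs₃⟩ := exists_cubic_roots he₂ he₃
  have hr₁0 : 0 < r₁ := by linarith
  have hr₂0 : 0 < r₂ := by linarith
  have hr₃0 : 0 < r₃ := by linarith
  have hp : (1 / 4 : ℝ) ≤ 1 / r₃ := one_div_le_one_div_of_le hr₃0 hr₃
  have hpq : 1 / r₃ ≤ 1 / r₂ := one_div_le_one_div_of_le hr₂0 hr₂₃
  have hqr : 1 / r₂ ≤ 1 / r₁ := one_div_le_one_div_of_le hr₁0 hr₁₂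
  have hr : 1 / r₁ ≤ 2 := by
    rw [div_le_iff₀ hr₁0]; linarith
  set x := prependThree (1 / r₃) (1 / r₂) (1 / r₁) y with hx
  have hδ : (0 : ℝ) < 1 / 4 := by norm_num
  have hge : ∀ n, 1 / 4 ≤ x n := prependThree_forall hp (hp.trans hpq)
    (hp.trans (hpq.trans hqr)) fun n => le_trans (by norm_num) (hy.two_le n)
  have hsum : Summable fun n => (x n ^ (l + 1))⁻¹ := (summable_nat_add_iff 3).1 hy.summable
  refine ⟨l, x, 1 / 4, hy.genus, hδ, hge,
    monotone_prependThree hpq hqr (hr.trans (hy.two_le 0)) hy.mono, hsum,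
    fun h hs => hy.not_summable h ((summable_nat_add_iff 3).2 hs),
    hy.entireOrder_prependThree hδ (by norm_num) hp hpq hqr hr, fun a ha => ?_⟩
  set Q : Polynomial ℝ := 1 - Polynomial.C 6 * Polynomial.X + Polynomial.C e₂ *
      Polynomial.X ^ 2 - Polynomial.C e₃ * Polynomial.X ^ 3 with hQ
  have hfac : ∀ z : ℂ, Polynomial.aeval z Q * (Complex.exp (a * z ^ 2) *
      (Complex.exp (((6 * l : ℝ) : ℂ) * z) * canonicalProduct l y z)) =
      Complex.exp (a * z ^ 2) * canonicalProduct l x z := by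
    intro z
    have h := canonicalProduct_add 3 hy.genus hδ hge hsum z
    have hprod : ∏ n ∈ Finset.range 3, zeroFactor l (x n) z =
        Polynomial.aeval z Q * Complex.exp (((6 * l : ℝ) : ℂ) * z) := by
      have := prod_zeroFactor_three l r₁ r₂ r₃ z
      rw [hs₁, hs₂, hs₃] at this
      simp only [Finset.prod_range_succ, Finset.prod_range_zero, one_mul]
      refine this.trans ?_
      simp [hQ]
    rw [h, hprod]
    change _ = _ * (_ * canonicalProduct l y z)
    ring
  have hm := (hasMaclaurinCoeffs_polynomial Q).mul ((hasMaclaurinCoeffs_expSq a).mul hEm)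
  simp only [hfac] at hm
  refine ⟨_, hm, hm.exists_coeff_mul_pos (fun k m hk hm hkm hzero => ?_) (fun Y => ?_) fun Y => ?_⟩
  · have hcoeff : ∀ k, 2 ≤ k → PowerSeries.coeff (2 * k) ((Q : PowerSeries ℝ) *
        (expSq a * (expLinear (6 * l) * G))) =
        (expSqCoeff (expLinear (6 * l) * G) (2 * k)).eval a
          - 6 * (expSqCoeff (expLinear (6 * l) * G) (2 * k - 1)).eval a
          + e₂ * (expSqCoeff (expLinear (6 * l) * G) (2 * k - 2)).eval a
          - e₃ * (expSqCoeff (expLinear (6 * l) * G) (2 * k - 3)).eval a := by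
      intro k hk
      -- The restriction `2 ≤ k` makes `2 * k - 3` a genuine subtraction.
      obtain ⟨n, hn⟩ : ∃ n, 2 * k = n + 3 := ⟨2 * k - 3, by omega⟩
      simp only [eval_expSqCoeff]
      rw [hn, show n + 3 - 1 = n + 2 by omega, show n + 3 - 2 = n + 1 by omega,
        show n + 3 - 3 = n by omega]
      exact coeff_cubic_mul _ 6 e₂ e₃ n
    rw [hcoeff k hk, hcoeff m hm] at hzero
    exact hgen a ha k m hk hm hkm hzero
  all_goals
    -- On the imaginary axis `exp (a z²)` is real and positive, so it does not affect the sign of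
    -- the real part.
    have hre : ∀ t : ℝ, (Complex.exp (a * (Complex.I * t) ^ 2) *
        canonicalProduct l x (Complex.I * t)).re =
        Real.exp (-a * t ^ 2) * (canonicalProduct l x (Complex.I * t)).re := fun t => by
      have : (a : ℂ) * (Complex.I * t) ^ 2 = ((-a * t ^ 2 : ℝ) : ℂ) := by
        rw [mul_pow, Complex.I_sq]; push_cast; ring
      rw [this, ← Complex.ofReal_exp, Complex.re_ofReal_mul]
  · obtain ⟨t, ht, ht'⟩ := (exists_re_canonicalProduct hy.genus hδ hge hsum Y).1
    exact ⟨t, ht, by rw [hre]; exact mul_nonneg (Real.exp_pos _).le ht'⟩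
  · obtain ⟨t, ht, ht'⟩ := (exists_re_canonicalProduct hy.genus hδ hge hsum Y).2
    exact ⟨t, ht, by rw [hre]; exact mul_nonpos_of_nonneg_of_nonpos (Real.exp_pos _).le ht'⟩

variable {l : ℕ} {x : ℕ → ℝ} {δ : ℝ}

theorem isRealEntire_exp_mul_canonicalProduct (hl : l = 0 ∨ l = 1) (hδ : 0 < δ)
    (hx : ∀ n, δ ≤ x n) (hs : Summable fun n => (x n ^ (l + 1))⁻¹) (a : ℝ) :
    IsRealEntire fun z : ℂ => Complex.exp (a * z ^ 2) * canonicalProduct l x z := by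
  refine ⟨Differentiable.mul (by fun_prop) (differentiable_canonicalProduct hl hδ hx hs),
    fun t => ?_⟩
  rw [← Complex.conj_eq_iff_im, map_mul, ← Complex.exp_conj, ← canonicalProduct_conj hl hδ hx hs]
  simp

theorem exp_mul_canonicalProduct_mem_laguerrePolyaA (hl : l = 0 ∨ l = 1) (hδ : 0 < δ)
    (hx : ∀ n, δ ≤ x n) (hs : Summable fun n => (x n ^ (l + 1))⁻¹) (hmono : Monotone x) {a : ℝ}
    (ha : a < 0) :
    (fun z : ℂ => Complex.exp (a * z ^ 2) * canonicalProduct l x z) ∈ LaguerrePolyaA := by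
  have hx0 : ∀ n, 0 < x n := fun n => hδ.trans_le (hx n)
  refine ⟨isRealEntire_exp_mul_canonicalProduct hl hδ hx hs a, a, ha.le, ha.ne, 1, 0, 0, l, ⊤, x,
    hl, fun k _ => (hx0 k).ne', ?_, ?_, fun z => ?_⟩
  · intro m _ n _ hmn
    simpa [abs_of_pos (hx0 _)] using hmono hmn
  · have : Summable fun n => (|x n| ^ (l + 1))⁻¹ := by simpa [abs_of_pos (hx0 _)] using hs
    exact this.subtype _
  · have huniv : {k : ℕ | (k : ℕ∞) < ⊤} = Set.univ := by
      ext k; simp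
    rw [huniv, tprod_univ fun k => zeroFactor l (x k) z]
    simp [canonicalProduct]

theorem isRealCanonicalProduct_canonicalProduct (hl : l = 0 ∨ l = 1) (hδ : 0 < δ)
    (hx : ∀ n, δ ≤ x n) (hs : Summable fun n => (x n ^ (l + 1))⁻¹) (hmono : Monotone x)
    (hns : l = 1 → ¬ Summable fun n => (x n)⁻¹) :
    IsRealCanonicalProduct (canonicalProduct l x) l x := by
  have hx0 : ∀ n, 0 < x n := fun n => hδ.trans_le (hx n)
  refine ⟨hl, fun n => (hx0 n).ne', ?_, ⟨?_, fun p hp => ?_⟩, hasProd_canonicalProduct hl hδ hx hs⟩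
  · simpa [abs_of_pos (hx0 _)] using hmono
  · simpa [abs_of_pos (hx0 _)] using hs
  · rcases hl with rfl | rfl
    · exact Nat.zero_le p
    · by_contra hlt
      obtain rfl : p = 0 := by omega
      exact hns rfl (by simpa [abs_of_pos (hx0 _)] using hp)

end Main

theorem theorem3 :
    (∀ ρ : ℝ, 0 ≤ ρ → ρ ≤ 2 →
      ∃ (ψ : ℂ → ℂ) (l : ℕ) (x : ℕ → ℝ),
        IsRealEntire ψ ∧ entireOrder ψ = (ρ : EReal) ∧ IsRealCanonicalProduct ψ l x ∧
        ∀ a : ℝ, a < 0 →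
          (fun z : ℂ => Complex.exp (a * z ^ 2) * ψ z) ∈ LaguerrePolyaA ∧
          ∃ α : ℕ → ℝ,
            HasMaclaurinCoeffs (fun z : ℂ => Complex.exp (a * z ^ 2) * ψ z) α ∧
            ∀ n₀ : ℕ, ∃ n > n₀, 0 < α (n - 1) * α (n + 1)) ∧
    ¬ SignPatternCharacterization := by
  constructor
  · intro ρ h0 h2
    obtain ⟨l, x, δ, hl, hδ, hx, hmono, hs, hns, hord, hfail⟩ :=
      exists_canonicalProduct_sign_failure h0 h2
    refine ⟨canonicalProduct l x, l, x, ?_, hord,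
      isRealCanonicalProduct_canonicalProduct hl hδ hx hs hmono hns, fun a ha =>
        ⟨exp_mul_canonicalProduct_mem_laguerrePolyaA hl hδ hx hs hmono ha, hfail a ha⟩⟩
    -- With `a = 0` the exponential factor is 1.
    simpa using isRealEntire_exp_mul_canonicalProduct hl hδ hx hs 0
  · intro hchar
    -- Any order and any `a < 0` would refute the characterization; `ρ = 0` and `a = -1` are taken.
    -- Only its forward implication is contradicted.
    obtain ⟨l, x, δ, hl, hδ, hx, hmono, hs, -, -, hfail⟩ :=
      exists_canonicalProduct_sign_failure le_rfl zero_le_two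
    obtain ⟨α, hα, hsign⟩ := hfail (-1) (by norm_num)
    obtain ⟨-, n₀, hn₀⟩ := (hchar _ α (isRealEntire_exp_mul_canonicalProduct hl hδ hx hs (-1))
      (fun z hz => by
        by_contra him
        refine mul_ne_zero (Complex.exp_ne_zero _) (canonicalProduct_ne_zero hl hδ hx hs ?_) hz
        rintro n rfl
        exact him (Complex.ofReal_im _)) hα).1
      (exp_mul_canonicalProduct_mem_laguerrePolyaA hl hδ hx hs hmono (by norm_num))
    obtain ⟨n, hn, hpos⟩ := hsign n₀
    exact absurd (hn₀ n hn) (not_le.2 hpos)
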